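/- **Setting.** Let $(\Gamma,d)$ be a countable metric space. For each $x\in\Gamma$ let $\mathcal H_x\neq\{0\}$ be a finite-dimensional complex Hilbert space. For finite $\Lambda\subset\Gamma$ put $\mathcal H_\Lambda=\bigotimes_{x\in\Lambda}\mathcal H_x$ and $\mathcal A_\Lambda=\mathcal B(\mathcal H_\Lambda)$ with the operator norm; for $X\subset\Lambda$, $\mathcal A_X$ is identified with $\mathcal A_X\otimes 1_{\Lambda\setminus X}\subset\mathcal A_\Lambda$. An *$F$-function* on $(\Gamma,d)$ is a non-increasing $F:[0,\infty)\to(0,\infty)$ with $\|F\|=\sup_{x\in\Gamma}\sum_{y\in\Gamma}F(d(x,y))<\infty$ for which there is $C>0$ with $\sum_{z\in\Gamma}F(d(x,z))F(d(z,y))\le C\,F(d(x,y))$ for all $x,y\in\Gamma$; $C_F$ denotes the infimum of all such $C$. A *dissipative interaction* is a family $\mathscr L=\{L_Z\}$, $Z\subset\Gamma$ finite, of linear maps $L_Z:\mathcal A_Z\to\mathcal A_Z$ of Lindblad form $$L_Z(A)=i[H,A]+\sum_{j=1}^{\ell}\Big(K_j^*AK_j-\tfrac12\{K_j^*K_j,A\}\Big),$$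 with $H=H^*$, $K_1,\dots,K_\ell\in\mathcal A_Z$, $\ell\in\mathbb N$ depending on $Z$. Its $F$-norm $\|\mathscr L\|_F$ is the infimum of all $M$ with $\sum_{Z\ni x,y}\|L_Z\|_{cb}\le M\,F(d(x,y))$ for all $x,y\in\Gamma$ ($\|\mathscr L\|_F=\infty$ if there is none), where $\|\Phi\|_{cb}=\sup_n\|\Phi\otimes\mathrm{id}_{M_n(\mathbb{C})}\|$. For finite $\Lambda$, let $\mathscr L^\Lambda=\sum_{Z\subset\Lambda}L_Z$ (each $L_Z$ extended to $L_Z\otimes\mathrm{id}$ on $\mathcal A_\Lambda$) and $T^\Lambda_t=e^{t\mathscr L^\Lambda}$, $t\ge0$. A state $\pi$ on $\mathcal A_\Lambda$ is a *local dynamical fixed-point of $\mathscr L$ with convergence governed by* $g_\Lambda:[0,\infty)\to[0,2]$ if $\pi\circ T^\Lambda_t=\pi$ for all $t\ge0$ and $|(\pi-\omega)(T^\Lambda_t(A))|\le g_\Lambda(t)\|A\|$ for all states $\omega$ on $\mathcal A_\Lambda$, all $A\in\mathcal A_\Lambda$ and all $t\ge0$. **Lemma 3.5.** Let $F_0$ be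 an $F$-function on $(\Gamma,d)$, let $a>0$, $F_a(r)=e^{-ar}F_0(r)$, and let $\mathscr L$ be a dissipative interaction with $0<\|\mathscr L\|_{F_a}<\infty$. Let $\Lambda\subset\Gamma$ be finite and let $\pi$ be a local dynamical fixed-point of $\mathscr L$ on $\mathcal A_\Lambda$ with convergence governed by $g_\Lambda$. Then for all non-empty $X,Y\subset\Lambda$ with $d(X,Y)=\min_{x\in X,y\in Y}d(x,y)>2$ and all $A\in\mathcal A_X$, $B\in\mathcal A_Y$, $$\begin{aligned}|\pi(AB)-\pi(A)\pi(B)|\le{}&2\|A\|\|B\|(|X|+|Y|)\,\|\mathscr L\|_{F_a}\|F_0\|\Big(t_a+\frac{C_{F_a}+\|F_a\|}{C_{F_a}}\int_0^{t_a}(e^{v_as}-1)\,ds\Big)e^{-\frac{a\,d(X,Y)}2}\\&+3\|A\|\|B\|\,g_\Lambda(t_a),\end{aligned}$$ where $v_a=\|\mathscr L\|_{F_a}C_{F_a}$ and $t_a=\dfrac{a\,d(X,Y)}{4v_a}$. -/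

import Mathlib

open scoped Matrix Matrix.Norms.L2Operator ComplexOrder

noncomputable section

namespace OpenSpin

/-! ### F-functions on a metric space -/

/-- `F : [0,∞) → (0,∞)` is non-increasing, uniformly summable and satisfies the convolution
condition.  The values of `F` at negative arguments are irrelevant. -/
structure IsFFunction (Γ : Type*) [MetricSpace Γ] (F : ℝ → ℝ) : Prop where
  pos : ∀ r, 0 ≤ r → 0 < F r
  antitone : AntitoneOn F (Set.Ici 0)
  summable : ∀ x : Γ, Summable fun y : Γ => F (dist x y)
  bounded : BddAbove (Set.range fun x : Γ => ∑' y : Γ, F (dist x y))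
  convolution : ∃ C : ℝ, 0 < C ∧ ∀ x y : Γ,
    (Summable fun z : Γ => F (dist x z) * F (dist z y)) ∧
      ∑' z : Γ, F (dist x z) * F (dist z y) ≤ C * F (dist x y)

/-- `‖F‖ = sup_x ∑_y F(d(x,y))`. -/
def FFunNorm (Γ : Type*) [MetricSpace Γ] (F : ℝ → ℝ) : ℝ :=
  ⨆ x : Γ, ∑' y : Γ, F (dist x y)

/-- The convolution constant `C_F`, the infimum of all admissible constants. -/
def convConst (Γ : Type*) [MetricSpace Γ] (F : ℝ → ℝ) : ℝ :=
  sInf {C : ℝ | 0 < C ∧ ∀ x y : Γ,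
    (Summable fun z : Γ => F (dist x z) * F (dist z y)) ∧
      ∑' z : Γ, F (dist x z) * F (dist z y) ≤ C * F (dist x y)}

/-- `F_a(r) = e^{-ar} F(r)`. -/
def expWeight (a : ℝ) (F : ℝ → ℝ) : ℝ → ℝ := fun r => Real.exp (-(a * r)) * F r

/-- `d(X,Y)`, the minimal distance between a point of `X` and a point of `Y`
(used for non-empty finite `X`, `Y`). -/
def setDist {Γ : Type*} [MetricSpace Γ] (X Y : Finset Γ) : ℝ :=
  ⨅ p : {x // x ∈ X} × {y // y ∈ Y}, dist (p.1 : Γ) (p.2 : Γ)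

/-! ### Maps on matrix algebras -/

/-- `Φ ⊗ id_n`: block-wise action of `Φ` on `n × n` block matrices with blocks in `M_σ(ℂ)`. -/
def ampliation {σ : Type*} (Φ : Matrix σ σ ℂ →ₗ[ℂ] Matrix σ σ ℂ) (n : ℕ) :
    Matrix (σ × Fin n) (σ × Fin n) ℂ →ₗ[ℂ] Matrix (σ × Fin n) (σ × Fin n) ℂ where
  toFun M := Matrix.of fun p q => Φ (Matrix.of fun i j => M (i, p.2) (j, q.2)) p.1 q.1
  map_add' M N := by
    ext p q
    exact congrFun (congrFun (Φ.map_add (Matrix.of fun i j => M (i, p.2) (j, q.2))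
      (Matrix.of fun i j => N (i, p.2) (j, q.2))) p.1) q.1
  map_smul' c M := by
    ext p q
    exact congrFun (congrFun (Φ.map_smul c (Matrix.of fun i j => M (i, p.2) (j, q.2))) p.1) q.1

/-- The completely bounded norm `‖Φ‖_cb = sup_n ‖Φ ⊗ id_n‖`, where all matrix algebras carry the
operator norm.  (On a full matrix algebra the supremum is always finite.) -/
def cbNorm {σ : Type*} [Fintype σ] [DecidableEq σ]
    (Φ : Matrix σ σ ℂ →ₗ[ℂ] Matrix σ σ ℂ) : ℝ :=
  ⨆ n : ℕ, ‖LinearMap.toContinuousLinearMap (ampliation Φ n)‖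

/-- `Φ` has Lindblad form. -/
def IsLindblad {σ : Type*} [Fintype σ] [DecidableEq σ]
    (Φ : Matrix σ σ ℂ →ₗ[ℂ] Matrix σ σ ℂ) : Prop :=
  ∃ H : Matrix σ σ ℂ, H.IsHermitian ∧ ∃ (ℓ : ℕ) (K : Fin ℓ → Matrix σ σ ℂ),
    ∀ A, Φ A = Complex.I • (H * A - A * H) +
      ∑ j, ((K j)ᴴ * A * K j - (1 / 2 : ℂ) • ((K j)ᴴ * K j * A + A * ((K j)ᴴ * K j)))

/-- A state: a positive linear functional of value `1` at the identity. -/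
structure IsState {σ : Type*} [Fintype σ] [DecidableEq σ]
    (ω : Matrix σ σ ℂ →ₗ[ℂ] ℂ) : Prop where
  nonneg : ∀ A, 0 ≤ ω (Aᴴ * A)
  map_one : ω 1 = 1

/-! ### The quantum spin system

The Hilbert space at `x` is `ℓ²(S x)`, `S x` indexing an orthonormal basis.  The Hilbert space of
a finite set `Λ` is then `⨂_{x ∈ Λ} ℓ²(S x) = ℓ²(∏_{x ∈ Λ} S x)`. -/

section Spin

variable {Γ : Type*} (S : Γ → Type*)

/-- Index set of the product basis of `𝓗_Λ`. -/
abbrev Config (Λ : Finset Γ) : Type _ := (x : {x // x ∈ Λ}) → S x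

/-- `𝓐_Λ = B(𝓗_Λ)`, written in the product basis, with the operator norm. -/
abbrev LocalAlg (Λ : Finset Γ) : Type _ := Matrix (Config S Λ) (Config S Λ) ℂ

variable {S}

/-- Restriction of a configuration to a smaller set. -/
def restrict {X Λ : Finset Γ} (h : X ⊆ Λ) (σ : Config S Λ) : Config S X :=
  fun x => σ ⟨x, h x.2⟩

open Classical in
/-- The configuration equal to `α` on `X` and to `σ` on `Λ \ X`. -/
def glue {X Λ : Finset Γ} (α : Config S X) (σ : Config S Λ) : Config S Λ :=
  fun x => if hx : (x : Γ) ∈ X then α ⟨x, hx⟩ else σ x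

open Classical in
/-- The inclusion `𝓐_X ⊂ 𝓐_Λ`, `A ↦ A ⊗ 1_{Λ \ X}`. -/
def embed {X Λ : Finset Γ} (h : X ⊆ Λ) (A : LocalAlg S X) : LocalAlg S Λ :=
  Matrix.of fun σ τ =>
    if ∀ x : {x // x ∈ Λ}, (x : Γ) ∉ X → σ x = τ x then A (restrict h σ) (restrict h τ) else 0

/-- The extension `Φ ⊗ id_{Λ \ Z}` to `𝓐_Λ` of a linear map `Φ` on `𝓐_Z`. -/
def extend {Z Λ : Finset Γ} (h : Z ⊆ Λ) (Φ : LocalAlg S Z →ₗ[ℂ] LocalAlg S Z) :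
    LocalAlg S Λ →ₗ[ℂ] LocalAlg S Λ where
  toFun A := Matrix.of fun σ τ =>
    Φ (Matrix.of fun α β => A (glue α σ) (glue β τ)) (restrict h σ) (restrict h τ)
  map_add' A B := by
    ext σ τ
    exact congrFun (congrFun (Φ.map_add (Matrix.of fun α β => A (glue α σ) (glue β τ))
      (Matrix.of fun α β => B (glue α σ) (glue β τ))) (restrict h σ)) (restrict h τ)
  map_smul' c A := by
    ext σ τ
    exact congrFun (congrFun (Φ.map_smul c (Matrix.of fun α β => A (glue α σ) (glue β τ)))
      (restrict h σ)) (restrict h τ)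

end Spin

section Interaction

variable {Γ : Type*} [DecidableEq Γ] (S : Γ → Type*)
  [∀ x, Fintype (S x)] [∀ x, DecidableEq (S x)]

/-- A dissipative interaction: a map `L_Z : 𝓐_Z → 𝓐_Z` in Lindblad form for each finite `Z`. -/
structure Interaction where
  L : (Z : Finset Γ) → LocalAlg S Z →ₗ[ℂ] LocalAlg S Z
  lindblad : ∀ Z, IsLindblad (L Z)

variable {S}

/-- `M` satisfies `∑_{Z ∋ x,y} ‖L_Z‖_cb ≤ M F(d(x,y))` for all `x, y`. -/
def IsFBound [MetricSpace Γ] (𝓛 : Interaction S) (F : ℝ → ℝ) (M : ℝ) : Prop :=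
  ∀ x y : Γ, (Summable fun Z : {Z : Finset Γ // x ∈ Z ∧ y ∈ Z} => cbNorm (𝓛.L Z)) ∧
    ∑' Z : {Z : Finset Γ // x ∈ Z ∧ y ∈ Z}, cbNorm (𝓛.L Z) ≤ M * F (dist x y)

/-- `‖𝓛‖_F < ∞`. -/
def HasFiniteFNorm [MetricSpace Γ] (𝓛 : Interaction S) (F : ℝ → ℝ) : Prop :=
  ∃ M, IsFBound 𝓛 F M

/-- The `F`-norm `‖𝓛‖_F`. -/
def FNorm [MetricSpace Γ] (𝓛 : Interaction S) (F : ℝ → ℝ) : ℝ := sInf {M | IsFBound 𝓛 F M}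

/-- The finite-volume generator `𝓛^Λ = ∑_{Z ⊆ Λ} L_Z`. -/
def generator (𝓛 : Interaction S) (Λ : Finset Γ) : LocalAlg S Λ →ₗ[ℂ] LocalAlg S Λ :=
  ∑ Z : {Z // Z ∈ Λ.powerset}, extend (Finset.mem_powerset.1 Z.2) (𝓛.L Z)

/-- The local dynamics `T_t^Λ = exp (t 𝓛^Λ)`. -/
def dynamics (𝓛 : Interaction S) (Λ : Finset Γ) (t : ℝ) : LocalAlg S Λ →L[ℂ] LocalAlg S Λ :=
  NormedSpace.exp ((t : ℂ) • LinearMap.toContinuousLinearMap (generator 𝓛 Λ))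

/-- `π` is a local dynamical fixed-point of `𝓛` in `Λ` with convergence governed by
`g : [0,∞) → [0,2]` (the values of `g` at negative arguments are irrelevant). -/
structure IsLocalDynamicalFixedPoint (𝓛 : Interaction S) (Λ : Finset Γ)
    (π : LocalAlg S Λ →ₗ[ℂ] ℂ) (g : ℝ → ℝ) : Prop where
  isState : IsState π
  invariant : ∀ t, 0 ≤ t → ∀ A, π (dynamics 𝓛 Λ t A) = π A
  range : ∀ t, 0 ≤ t → g t ∈ Set.Icc (0 : ℝ) 2
  convergence : ∀ ω : LocalAlg S Λ →ₗ[ℂ] ℂ, IsState ω → ∀ A t, 0 ≤ t →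
    ‖π (dynamics 𝓛 Λ t A) - ω (dynamics 𝓛 Λ t A)‖ ≤ g t * ‖A‖

end Interaction

end OpenSpin

end

/-! Compare `π` with a product state `ω`, a diagonal vector state. Invariance of `π` and convergence
give `π(N) ≈ ω(T_t N)` with error `g t * ‖N‖`, for `N` equal to `AB`, `A` and `B`; this is the term
`3‖A‖‖B‖ g t`. It remains to see that `ω ∘ T_t` nearly factorizes on `AB`. Put `d = d(X,Y)`, let `U`
and `V` be the disjoint `d/2`-neighbourhoods of `X` and `Y` in `Λ`, and keep only the interaction
terms inside `U` or inside `V`. The decoupled generator obeys the Leibniz rule on products from the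
algebras of `U` and `V`, so its semigroup is multiplicative there and `ω` factorizes exactly
(`diagState_partialDynamics_mul`).

The cost of decoupling is a Duhamel integral of the discarded terms acting on the decoupled
evolution. Each discarded term contains a point at distance at least `d/2` from any given point of
`X` or of `Y`, so a Lieb-Robinson bound (`lieb_robinson`) together with the weight `e^{-ar}` yields
`e^{-ad/2} (e^{vt} - 1)/C` per site (`norm_dynamics_sub_le`). This works for every `t ≥ 0`
(`norm_correlation_le`); at `t = ad/(4v)` the growth `e^{vt}` is `e^{ad/4}`, half the decay
exponent.

The analysis rests on one fact: Lindblad generators are dissipative, so that every subfamily of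
terms generates contractions and Duhamel estimates lose no constants
(`norm_le_add_sub_of_dissipative`, `IsNormDecreasing.isDissipative`). -/

noncomputable section

namespace OpenSpin

/-! ### Dissipative evolution equations -/

section Dissipative

open Filter Topology Set

/-- A Duhamel-type estimate: if `D` is dissipative and `y' = D y + ρ` with `‖ρ‖ ≤ P'`, then
`‖y‖` grows at most like `P`. -/
theorem norm_le_add_sub_of_dissipative {V : Type*} [NormedAddCommGroup V] [NormedSpace ℝ V]
    {D : V → V} (hD : ∀ x, ∀ h : ℝ, 0 ≤ h → ‖x‖ ≤ ‖x - h • D x‖)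
    {y ρ : ℝ → V} {P P' : ℝ → ℝ} {t : ℝ} (ht : 0 ≤ t)
    (hy : ∀ s, HasDerivAt y (D (y s) + ρ s) s) (hP : ∀ s, HasDerivAt P (P' s) s)
    (hρ : ∀ s, 0 ≤ s → ‖ρ s‖ ≤ P' s) :
    ‖y t‖ ≤ ‖y 0‖ + (P t - P 0) := by
  have hyc : Continuous y := continuous_iff_continuousAt.2 fun s => (hy s).continuousAt
  have hPc : Continuous P := continuous_iff_continuousAt.2 fun s => (hP s).continuousAt
  -- Time is reversed because dissipativity bounds `‖y u‖` by the norm of a backward Euler step,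
  -- that is, by `‖y (u - h)‖` up to small errors, while the comparison theorem uses right slopes.
  -- At `s = t` the comparison is the claim.
  have key := image_le_of_liminf_slope_right_le_deriv_boundary
    (f := fun s => -‖y (t - s)‖) (a := 0) (b := t)
    (B := fun s => -‖y t‖ + (P t - P (t - s))) (B' := fun s => P' (t - s))
    (by fun_prop) (by simp) (by fun_prop)
    (fun s _ => by
      have h1 : HasDerivAt (fun s : ℝ => t - s) (-1) s := by
        simpa using (hasDerivAt_id s).const_sub t
      have h2 := ((hP (t - s)).comp s h1)
      have h3 := (h2.const_sub (P t)).const_add (-‖y t‖)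
      simpa using! h3.hasDerivWithinAt) ?_ (right_mem_Icc.2 ht)
  · simp only [sub_self] at key
    linarith
  intro s hs r hr
  apply Eventually.frequently
  set u := t - s with hu
  have hu0 : 0 ≤ u := by have := hs.2; simp only [hu]; linarith
  have hlit := (hasDerivAt_iff_isLittleO.1 (hy u)).def (half_pos (sub_pos.2 hr))
  have htend : Tendsto (fun z : ℝ => t - z) (𝓝[>] s) (𝓝 u) :=
    ((continuous_const.sub continuous_id).tendsto s).mono_left nhdsWithin_le_nhds
  filter_upwards [htend.eventually hlit, self_mem_nhdsWithin] with z hz hzs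
  have hzs : s < z := hzs
  have hh : 0 < z - s := sub_pos.2 hzs
  rw [slope_def_field, div_lt_iff₀ hh]
  have e1 : t - z - u = -(z - s) := by rw [hu]; ring
  rw [e1, norm_neg, Real.norm_of_nonneg hh.le] at hz
  set h := z - s
  have e2 : y (t - z) - (y u - h • D (y u))
      = (y (t - z) - y u - (-h) • (D (y u) + ρ u)) - h • ρ u := by
    rw [smul_add, neg_smul, neg_smul]; abel
  have h1 : ‖y (t - z) - (y u - h • D (y u))‖ ≤ (r - P' u) / 2 * h + h * P' u := by
    rw [e2]
    refine (norm_sub_le _ _).trans (add_le_add hz ?_)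
    rw [norm_smul, Real.norm_of_nonneg hh.le]
    exact mul_le_mul_of_nonneg_left (hρ u hu0) hh.le
  have h2 := hD (y u) h hh.le
  have h3 := norm_sub_norm_le (y u - h • D (y u)) (y (t - z))
  rw [norm_sub_rev _ (y (t - z))] at h3
  have h4 : 0 < (r - P' u) / 2 * h := mul_pos (half_pos (sub_pos.2 hr)) hh
  change -‖y (t - z)‖ - -‖y u‖ < _
  linarith

/-- The semigroup generated by a bounded operator. -/
def semigroup {V : Type*} [NormedAddCommGroup V] [NormedSpace ℂ V] (D : V →L[ℂ] V) (t : ℝ) :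
    V →L[ℂ] V := NormedSpace.exp ((t : ℂ) • D)

variable {V : Type*} [NormedAddCommGroup V] [NormedSpace ℂ V]

/-- Dissipativity of a bounded operator. -/
def IsDissipative (D : V →L[ℂ] V) : Prop := ∀ x, ∀ h : ℝ, 0 ≤ h → ‖x‖ ≤ ‖x - (h : ℂ) • D x‖

theorem IsDissipative.real {D : V →L[ℂ] V} (hD : IsDissipative D) (x : V) (h : ℝ) (hh : 0 ≤ h) :
    ‖x‖ ≤ ‖x - h • D x‖ := by
  simpa using hD x h hh

@[simp] theorem semigroup_zero (D : V →L[ℂ] V) : semigroup D 0 = 1 := by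
  simp [semigroup]

variable [CompleteSpace V]

theorem hasDerivAt_semigroup (D : V →L[ℂ] V) (x : V) (t : ℝ) :
    HasDerivAt (fun s => semigroup D s x) (D (semigroup D t x)) t := by
  have h := hasDerivAt_exp_smul_const' (𝕂 := ℝ) D t
  simp only [← Complex.coe_smul] at h
  have h2 := ((ContinuousLinearMap.apply ℂ V x).restrictScalars ℝ).hasFDerivAt.comp_hasDerivAt t h
  exact h2

theorem norm_semigroup_le {D : V →L[ℂ] V} (hD : IsDissipative D) {t : ℝ} (ht : 0 ≤ t) (x : V) :
    ‖semigroup D t x‖ ≤ ‖x‖ := by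
  have := norm_le_add_sub_of_dissipative (ρ := fun _ => (0 : V)) (P := fun _ => 0)
    (P' := fun _ => 0) hD.real ht
    (fun s => by simpa using hasDerivAt_semigroup D x s) (fun s => hasDerivAt_const s 0)
    (by simp)
  simpa using this

/-- Duhamel: the difference of the evolutions is driven by `D` with source `(D' - D)` applied to the
`D'`-evolution. Locality is therefore needed only for the `D'`-evolution, here the truncated one. -/
theorem norm_semigroup_sub_semigroup_le {D D' : V →L[ℂ] V} (hD : IsDissipative D) (x : V)
    {P P' : ℝ → ℝ} {t : ℝ} (ht : 0 ≤ t) (hP : ∀ s, HasDerivAt P (P' s) s)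
    (hρ : ∀ s, 0 ≤ s → ‖D (semigroup D' s x) - D' (semigroup D' s x)‖ ≤ P' s) :
    ‖semigroup D t x - semigroup D' t x‖ ≤ P t - P 0 := by
  have := norm_le_add_sub_of_dissipative
    (ρ := fun s => D' (semigroup D' s x) - D (semigroup D' s x))
    (y := fun s => semigroup D' s x - semigroup D s x) hD.real ht
    (fun s => by
      have := (hasDerivAt_semigroup D' x s).sub (hasDerivAt_semigroup D x s)
      convert! this using 1
      rw [map_sub]
      abel) hP (fun s hs => by rw [norm_sub_rev]; exact hρ s hs)
  rw [norm_sub_rev]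
  simpa using this

/-- The basic step in the Lieb-Robinson iteration. -/
theorem norm_apply_semigroup_le {K D D₁ D₂ : V →L[ℂ] V} (hD : D = D₁ + D₂)
    (hD₁ : IsDissipative D₁) (hcomm : ∀ x, K (D₁ x) = D₁ (K x)) (x : V)
    {P P' : ℝ → ℝ} {t : ℝ} (ht : 0 ≤ t) (hP : ∀ s, HasDerivAt P (P' s) s)
    (hρ : ∀ s, 0 ≤ s → ‖K (D₂ (semigroup D s x))‖ ≤ P' s) :
    ‖K (semigroup D t x)‖ ≤ ‖K x‖ + (P t - P 0) := by
  -- Since `K` commutes with `D₁`, the curve `K y` is again driven by `D₁`, and only `K D₂ y` acts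
  -- as a source.
  have := norm_le_add_sub_of_dissipative
    (ρ := fun s => K (D₂ (semigroup D s x)))
    (y := fun s => K (semigroup D s x)) hD₁.real ht
    (fun s => by
      have := (K.restrictScalars ℝ).hasFDerivAt.comp_hasDerivAt s (hasDerivAt_semigroup D x s)
      have e : D (semigroup D s x) = D₁ (semigroup D s x) + D₂ (semigroup D s x) := by
        rw [← add_apply, ← hD]
      rw [e] at this
      simpa [hcomm] using! this) hP hρ
  simpa using this

theorem semigroup_mem {D : V →L[ℂ] V} {M : Submodule ℂ V} (hM : IsClosed (M : Set V))
    (hDM : ∀ x ∈ M, D x ∈ M) {x : V} (hx : x ∈ M) (t : ℝ) : semigroup D t x ∈ M := by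
  have h1 := NormedSpace.exp_series_hasSum_exp' (𝕂 := ℂ) ((t : ℂ) • D)
  have h2 := h1.mapL (ContinuousLinearMap.apply ℂ V x)
  have hpow : ∀ n : ℕ, (((t : ℂ) • D) ^ n) x ∈ M := by
    intro n
    induction n with
    | zero => simpa using hx
    | succ n ih =>
      rw [pow_succ']
      exact M.smul_mem _ (hDM _ ih)
  refine hM.mem_of_tendsto h2 (Eventually.of_forall fun s => M.sum_mem fun n _ => ?_)
  exact M.smul_mem _ (hpow n)

/-- A generator acting as a derivation on products from two invariant subspaces generates a
semigroup that is multiplicative on such products. -/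
theorem semigroup_mul {R : Type*} [NormedRing R] [NormedAlgebra ℂ R] [CompleteSpace R]
    {D : R →L[ℂ] R} (hD : IsDissipative D) {M N : Submodule ℂ R} (hM : IsClosed (M : Set R))
    (hN : IsClosed (N : Set R)) (hDM : ∀ x ∈ M, D x ∈ M) (hDN : ∀ x ∈ N, D x ∈ N)
    (hmul : ∀ p ∈ M, ∀ q ∈ N, D (p * q) = D p * q + p * D q) {p q : R} (hp : p ∈ M) (hq : q ∈ N)
    {t : ℝ} (ht : 0 ≤ t) : semigroup D t (p * q) = semigroup D t p * semigroup D t q := by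
  -- The multiplicativity defect solves `y' = D y` with `y 0 = 0`, by the Leibniz rule on the
  -- invariant subspaces; without a source it stays zero.
  have := norm_le_add_sub_of_dissipative (ρ := fun _ => (0 : R)) (P := fun _ => 0)
    (P' := fun _ => 0) (y := fun s => semigroup D s (p * q) - semigroup D s p * semigroup D s q)
    hD.real ht
    (fun s => by
      have := (hasDerivAt_semigroup D (p * q) s).sub
        ((hasDerivAt_semigroup D p s).mul (hasDerivAt_semigroup D q s))
      rw [← hmul _ (semigroup_mem hM hDM hp s) _ (semigroup_mem hN hDN hq s), ← map_sub] at this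
      simpa using! this) (fun s => hasDerivAt_const s 0)
    (by simp)
  simpa [sub_eq_zero] using this

end Dissipative

/-! ### Lindblad generators are dissipative -/

section Matrix

open Matrix

variable {n : Type*} [Fintype n] [DecidableEq n]

/-- The operator on Euclidean space given by a matrix. -/
local notation "𝖳" => Matrix.toEuclideanCLM (n := n) (𝕜 := ℂ)

theorem exists_norm_eq [Nonempty n] (A : Matrix n n ℂ) :
    ∃ ξ : EuclideanSpace ℂ n, ‖ξ‖ = 1 ∧ ‖𝖳 A ξ‖ = ‖A‖ := by
  have hne : (Metric.sphere (0 : EuclideanSpace ℂ n) 1).Nonempty :=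
    NormedSpace.sphere_nonempty.2 zero_le_one
  obtain ⟨ξ, hξ, hmax⟩ := (isCompact_sphere (0 : EuclideanSpace ℂ n) 1).exists_isMaxOn hne
    (f := fun ξ => ‖𝖳 A ξ‖) (by fun_prop)
  have hξ1 : ‖ξ‖ = 1 := by simpa using hξ
  refine ⟨ξ, hξ1, le_antisymm ?_ ?_⟩
  · have := (𝖳 A).le_opNorm ξ
    rwa [hξ1, mul_one, l2_opNorm_toEuclideanCLM] at this
  · rw [← l2_opNorm_toEuclideanCLM]
    refine ContinuousLinearMap.opNorm_le_of_unit_norm (norm_nonneg _) fun x hx => ?_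
    exact hmax (by simpa using hx)

theorem inner_conjTranspose (A : Matrix n n ℂ) (x y : EuclideanSpace ℂ n) :
    inner ℂ x (𝖳 Aᴴ y) = inner ℂ (𝖳 A x) y := by
  have : 𝖳 Aᴴ = ContinuousLinearMap.adjoint (𝖳 A) := map_star 𝖳 A
  rw [this, ContinuousLinearMap.adjoint_inner_right]

/-- Equality case of Cauchy-Schwarz: `⟨ξ, A*Aξ⟩ = ‖A‖²` and `‖A*Aξ‖ ≤ ‖A‖²` make the squared
distance at most `‖A‖⁴ - 2‖A‖⁴ + ‖A‖⁴ = 0`. -/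
theorem conjTranspose_apply_of_norm_eq (A : Matrix n n ℂ) {ξ : EuclideanSpace ℂ n}
    (hξ : ‖ξ‖ = 1) (h : ‖𝖳 A ξ‖ = ‖A‖) : 𝖳 Aᴴ (𝖳 A ξ) = ((‖A‖ : ℂ) ^ 2) • ξ := by
  have h1 : ‖𝖳 Aᴴ (𝖳 A ξ)‖ ≤ ‖A‖ ^ 2 := by
    refine ((𝖳 Aᴴ).le_opNorm _).trans ?_
    rw [l2_opNorm_toEuclideanCLM, l2_opNorm_conjTranspose, h, sq]
  have h2 : ‖𝖳 Aᴴ (𝖳 A ξ) - ((‖A‖ : ℂ) ^ 2) • ξ‖ ^ 2 ≤ 0 := by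
    rw [@norm_sub_sq ℂ, inner_smul_right, ← inner_conj_symm, inner_conjTranspose,
      inner_self_eq_norm_sq_to_K, h, norm_smul, hξ]
    have : (‖A‖ : ℂ) ^ 2 * (starRingEnd ℂ) ((‖A‖ : ℂ) ^ 2) = ((‖A‖ ^ 4 : ℝ) : ℂ) := by
      simp only [map_pow, Complex.conj_ofReal]; push_cast; ring
    have e : RCLike.re ((‖A‖ : ℂ) ^ 2 * (starRingEnd ℂ) ((‖A‖ : ℂ) ^ 2)) = ‖A‖ ^ 4 := by
      rw [this]; exact Complex.ofReal_re _
    simp only [Complex.coe_algebraMap] at *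
    rw [e]
    simp only [norm_pow, Complex.norm_real, norm_norm, mul_one]
    nlinarith [pow_le_pow_left₀ (norm_nonneg _) h1 2]
  rw [← sub_eq_zero, ← norm_eq_zero]
  exact pow_eq_zero_iff (two_ne_zero) |>.1 (le_antisymm h2 (sq_nonneg _))

/-- Infinitesimal dissipativity at norming vectors. -/
def IsNormDecreasing (Φ : Matrix n n ℂ →ₗ[ℂ] Matrix n n ℂ) : Prop :=
  ∀ (A : Matrix n n ℂ) (ξ : EuclideanSpace ℂ n), 𝖳 Aᴴ (𝖳 A ξ) = ((‖A‖ : ℂ) ^ 2) • ξ →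
    (inner ℂ (𝖳 A ξ) (𝖳 (Φ A) ξ) : ℂ).re ≤ 0

/-- At a fixed norming vector the condition is linear in `Φ`, whereas the norm inequality defining
dissipativity is not visibly additive. -/
theorem IsNormDecreasing.sum {ι : Type*} (s : Finset ι)
    {Φ : ι → Matrix n n ℂ →ₗ[ℂ] Matrix n n ℂ} (h : ∀ i ∈ s, IsNormDecreasing (Φ i)) :
    IsNormDecreasing (∑ i ∈ s, Φ i) := by
  intro A ξ hξ
  have : 𝖳 ((∑ i ∈ s, Φ i) A) ξ = ∑ i ∈ s, 𝖳 (Φ i A) ξ := by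
    rw [LinearMap.sum_apply, map_sum, _root_.sum_apply]
  rw [this, inner_sum, Complex.re_sum]
  exact Finset.sum_nonpos fun i hi => h i hi A ξ hξ

/-- With `a = Aξ` one has `⟨a, Ax⟩ = ‖A‖²⟨ξ, x⟩`. The Hamiltonian part then contributes `i` times a
real number, and each jump operator at most `-(‖Ka‖ - ‖A‖‖Kξ‖)²/2`. -/
theorem IsLindblad.isNormDecreasing {Φ : Matrix n n ℂ →ₗ[ℂ] Matrix n n ℂ} (h : IsLindblad Φ) :
    IsNormDecreasing Φ := by
  obtain ⟨H, hH, ℓ, K, hΦ⟩ := h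
  intro A ξ hξ
  set a := 𝖳 A ξ with ha
  have hA : ∀ x, inner ℂ a (𝖳 A x) = (‖A‖ : ℂ) ^ 2 * inner ℂ ξ x := by
    intro x
    have := inner_conjTranspose Aᴴ a x
    rw [conjTranspose_conjTranspose, hξ, inner_smul_left] at this
    simpa using this
  have hreal : ∀ x, (inner ℂ x (𝖳 H x) : ℂ).im = 0 := by
    intro x
    have h1 := inner_conjTranspose H x x
    rw [hH.eq, ← inner_conj_symm] at h1
    rw [← inner_conj_symm, h1] at h1
    exact Complex.conj_eq_iff_im.1 (by rw [inner_conj_symm, ← inner_conjTranspose, hH.eq])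
  have hK : ∀ j, (inner ℂ a (𝖳 ((K j)ᴴ * A * K j -
      (1 / 2 : ℂ) • ((K j)ᴴ * K j * A + A * ((K j)ᴴ * K j))) ξ) : ℂ).re ≤ 0 := by
    intro j
    have e : 𝖳 ((K j)ᴴ * A * K j - (1 / 2 : ℂ) • ((K j)ᴴ * K j * A + A * ((K j)ᴴ * K j))) ξ
        = 𝖳 (K j)ᴴ (𝖳 A (𝖳 (K j) ξ)) -
          (1 / 2 : ℂ) • (𝖳 (K j)ᴴ (𝖳 (K j) a) + 𝖳 A (𝖳 (K j)ᴴ (𝖳 (K j) ξ))) := by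
      simp [map_sub, map_smul, map_add, map_mul, ha]
    rw [e, inner_sub_right, inner_smul_right, inner_add_right, hA, inner_conjTranspose,
      inner_conjTranspose, inner_conjTranspose, inner_self_eq_norm_sq_to_K,
      inner_self_eq_norm_sq_to_K]
    have h1 : (inner ℂ (𝖳 (K j) a) (𝖳 A (𝖳 (K j) ξ)) : ℂ).re
        ≤ ‖𝖳 (K j) a‖ * (‖A‖ * ‖𝖳 (K j) ξ‖) := by
      refine (re_inner_le_norm (𝕜 := ℂ) _ _).trans ?_
      exact mul_le_mul_of_nonneg_left ((𝖳 A).le_opNorm _) (norm_nonneg _)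
    have h2 : ((1 / 2 : ℂ) * ((‖𝖳 (K j) a‖ : ℂ) ^ 2 + (‖A‖ : ℂ) ^ 2 * (‖𝖳 (K j) ξ‖ : ℂ) ^ 2)).re
        = 1 / 2 * (‖𝖳 (K j) a‖ ^ 2 + ‖A‖ ^ 2 * ‖𝖳 (K j) ξ‖ ^ 2) := by
      rw [← Complex.ofReal_re (1 / 2 * (‖𝖳 (K j) a‖ ^ 2 + ‖A‖ ^ 2 * ‖𝖳 (K j) ξ‖ ^ 2))]
      push_cast
      rfl
    rw [Complex.sub_re]
    simp only [Complex.coe_algebraMap]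
    rw [h2]
    nlinarith [sq_nonneg (‖𝖳 (K j) a‖ - ‖A‖ * ‖𝖳 (K j) ξ‖)]
  have e : 𝖳 (Φ A) ξ = Complex.I • (𝖳 H a - 𝖳 A (𝖳 H ξ)) +
      ∑ j, 𝖳 ((K j)ᴴ * A * K j - (1 / 2 : ℂ) • ((K j)ᴴ * K j * A + A * ((K j)ᴴ * K j))) ξ := by
    rw [hΦ, map_add, map_sum, _root_.add_apply, _root_.sum_apply]
    simp [map_sub, map_smul, map_mul, ha]
  rw [e, inner_add_right, inner_sum, Complex.add_re, Complex.re_sum, inner_smul_right,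
    inner_sub_right, hA]
  have h0 : (Complex.I * (inner ℂ a (𝖳 H a) - (‖A‖ : ℂ) ^ 2 * inner ℂ ξ (𝖳 H ξ))).re = 0 := by
    have : ((‖A‖ : ℂ) ^ 2 * inner ℂ ξ (𝖳 H ξ)).im = 0 := by
      rw [← Complex.ofReal_pow, Complex.im_ofReal_mul, hreal, mul_zero]
    rw [Complex.I_mul_re, Complex.sub_im, hreal, this]; simp
  rw [h0, zero_add]
  exact Finset.sum_nonpos fun j _ => hK j

/-- Test against a norming unit vector `ξ`: `‖A‖ ‖A - tΦA‖ ≥ Re⟨Aξ, (A - tΦA)ξ⟩ ≥ ‖A‖²`. -/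
theorem IsNormDecreasing.isDissipative {Φ : Matrix n n ℂ →ₗ[ℂ] Matrix n n ℂ}
    (h : IsNormDecreasing Φ) : IsDissipative (LinearMap.toContinuousLinearMap Φ) := by
  intro A t ht
  change ‖A‖ ≤ ‖A - (t : ℂ) • Φ A‖
  rcases isEmpty_or_nonempty n with hn | hn
  · rw [Subsingleton.elim A 0]; simp
  obtain ⟨ξ, hξ, hA⟩ := exists_norm_eq A
  have hc := conjTranspose_apply_of_norm_eq A hξ hA
  have h1 := h A ξ hc
  rcases (norm_nonneg A).eq_or_lt with h0 | h0
  · rw [← h0]; exact norm_nonneg _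
  refine le_of_mul_le_mul_left ?_ h0
  have h2 : (inner ℂ (𝖳 A ξ) (𝖳 (A - (t : ℂ) • Φ A) ξ) : ℂ).re ≤ ‖A‖ * ‖A - (t : ℂ) • Φ A‖ := by
    refine (re_inner_le_norm (𝕜 := ℂ) _ _).trans ?_
    rw [hA]
    refine mul_le_mul_of_nonneg_left ?_ (norm_nonneg _)
    refine ((𝖳 _).le_opNorm _).trans ?_
    rw [hξ, mul_one, l2_opNorm_toEuclideanCLM]
  have h3 : (inner ℂ (𝖳 A ξ) (𝖳 (A - (t : ℂ) • Φ A) ξ) : ℂ).re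
      = ‖A‖ * ‖A‖ - t * (inner ℂ (𝖳 A ξ) (𝖳 (Φ A) ξ) : ℂ).re := by
    rw [map_sub, map_smul, _root_.sub_apply, _root_.smul_apply, inner_sub_right, inner_smul_right,
      inner_self_eq_norm_sq_to_K, hA, Complex.sub_re, Complex.re_ofReal_mul, sq]
    simp
  nlinarith [mul_nonneg ht (neg_nonneg.2 h1)]

/-! ### States -/

/-- Polarization: `ω (B* B)` is real for `B = A + 1` and for `B = A + i`. -/
theorem IsState.apply_conjTranspose {ω : Matrix n n ℂ →ₗ[ℂ] ℂ} (hω : IsState ω)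
    (A : Matrix n n ℂ) : ω Aᴴ = (starRingEnd ℂ) (ω A) := by
  have hp : ∀ B, (ω (Bᴴ * B)).im = 0 := fun B => ((Complex.le_def.1 (hω.nonneg B)).2).symm
  have h1 := hp (A + 1)
  have h2 := hp (A + Complex.I • 1)
  have h0 := hp A
  have h3 := hp 1
  simp only [conjTranspose_add, conjTranspose_smul, conjTranspose_one, add_mul, mul_add, mul_one,
    one_mul, map_add, Complex.add_im, smul_mul_assoc, mul_smul_comm, map_smul, smul_eq_mul,
    hω.map_one] at h1 h2 h3
  apply Complex.ext <;> simp at h0 h1 h2 h3 ⊢ <;> linarith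

open scoped MatrixOrder in
theorem IsState.apply_conjTranspose_mul_self_le {ω : Matrix n n ℂ →ₗ[ℂ] ℂ} (hω : IsState ω)
    (A : Matrix n n ℂ) : ω (Aᴴ * A) ≤ ((‖A‖ ^ 2 : ℝ) : ℂ) := by
  have h := CStarAlgebra.star_mul_le_algebraMap_norm_sq (a := A)
  obtain ⟨B, hB⟩ := CStarAlgebra.nonneg_iff_eq_star_mul_self.1 (sub_nonneg.2 h)
  have h2 := hω.nonneg B
  rw [← star_eq_conjTranspose, ← hB, map_sub, Algebra.algebraMap_eq_smul_one,
    ← Complex.coe_smul, map_smul, hω.map_one, smul_eq_mul, mul_one] at h2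
  exact sub_nonneg.1 h2

/-- Nonnegativity of the variance `ω(A*A) - |ω(A)|²`. -/
theorem IsState.norm_apply_le {ω : Matrix n n ℂ →ₗ[ℂ] ℂ} (hω : IsState ω)
    (A : Matrix n n ℂ) : ‖ω A‖ ≤ ‖A‖ := by
  have h1 := hω.nonneg (A - (ω A) • 1)
  have e1 : ω ((A - (ω A) • 1)ᴴ * (A - (ω A) • 1)) = ω (Aᴴ * A) - ((‖ω A‖ ^ 2 : ℝ) : ℂ) := by
    simp only [conjTranspose_sub, conjTranspose_smul, conjTranspose_one, sub_mul, mul_sub, mul_one,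
      one_mul, map_sub, smul_mul_assoc, mul_smul_comm, map_smul, smul_eq_mul, hω.map_one,
      hω.apply_conjTranspose]
    have := Complex.mul_conj (ω A)
    rw [Complex.normSq_eq_norm_sq] at this
    rw [← this]
    simp
    ring
  rw [e1] at h1
  have h3 : ((‖ω A‖ ^ 2 : ℝ) : ℂ) ≤ ((‖A‖ ^ 2 : ℝ) : ℂ) :=
    
    (sub_nonneg.1 h1).trans (hω.apply_conjTranspose_mul_self_le A)
  exact le_of_sq_le_sq (Complex.real_le_real.1 h3) (norm_nonneg _)

/-- The vector state of a basis vector. -/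
def diagState (i : n) : Matrix n n ℂ →ₗ[ℂ] ℂ where
  toFun A := A i i
  map_add' _ _ := rfl
  map_smul' _ _ := rfl

theorem isState_diagState (i : n) : IsState (diagState i) where
  nonneg A := (posSemidef_conjTranspose_mul_self A).diag_nonneg
  map_one := one_apply_eq i

end Matrix

/-! ### Tensor extensions of matrices and maps -/

section Tensor

open Matrix Kronecker

/-- The Lindblad form with Hamiltonian `H` and jump operators `K`. -/
def lindbladMap {σ : Type*} [Fintype σ] {ℓ : ℕ} (H : Matrix σ σ ℂ)
    (K : Fin ℓ → Matrix σ σ ℂ) (A : Matrix σ σ ℂ) : Matrix σ σ ℂ :=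
  Complex.I • (H * A - A * H) +
    ∑ j, ((K j)ᴴ * A * K j - (1 / 2 : ℂ) • ((K j)ᴴ * K j * A + A * ((K j)ᴴ * K j)))

variable {κ σ τ : Type*}

/-- The block of a matrix at a pair of indices of the second factor. -/
def slice (e : κ ≃ σ × τ) (M : Matrix κ κ ℂ) (p q : τ) : Matrix σ σ ℂ :=
  Matrix.of fun i j => M (e.symm (i, p)) (e.symm (j, q))

theorem apply_eq_slice (e : κ ≃ σ × τ) (M : Matrix κ κ ℂ) (k l : κ) :
    M k l = slice e M (e k).2 (e l).2 (e k).1 (e l).1 := by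
  simp [slice]

theorem ext_slice (e : κ ≃ σ × τ) {M N : Matrix κ κ ℂ}
    (h : ∀ p q, slice e M p q = slice e N p q) : M = N := by
  ext k l
  rw [apply_eq_slice e M, h, ← apply_eq_slice e N]

/-- `Φ ⊗ id`, transported along `e : κ ≃ σ × τ`. -/
def tensorExt (e : κ ≃ σ × τ) (Φ : Matrix σ σ ℂ →ₗ[ℂ] Matrix σ σ ℂ) (M : Matrix κ κ ℂ) :
    Matrix κ κ ℂ :=
  Matrix.of fun k l => Φ (slice e M (e k).2 (e l).2) (e k).1 (e l).1

theorem ampliation_apply_eq (Φ : Matrix σ σ ℂ →ₗ[ℂ] Matrix σ σ ℂ) (n : ℕ)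
    (M : Matrix (σ × Fin n) (σ × Fin n) ℂ) :
    ampliation Φ n M = tensorExt (Equiv.refl (σ × Fin n)) Φ M := rfl

variable [Fintype κ] [Fintype σ] [Fintype τ]
  [DecidableEq κ] [DecidableEq σ] [DecidableEq τ]

/-- `A ↦ A ⊗ 1`, transported along `e : κ ≃ σ × τ`. -/
def tensorHom (e : κ ≃ σ × τ) : Matrix σ σ ℂ →⋆ₐ[ℂ] Matrix κ κ ℂ where
  toFun A := (A ⊗ₖ (1 : Matrix τ τ ℂ)).submatrix e e
  map_one' := by simp
  map_mul' A B := by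
    rw [submatrix_mul_equiv, ← mul_kronecker_mul, one_mul]
  map_zero' := by simp
  map_add' A B := by rw [add_kronecker]; rfl
  commutes' c := by
    rw [Algebra.algebraMap_eq_smul_one, Algebra.algebraMap_eq_smul_one, smul_kronecker,
      one_kronecker_one]
    change c • (1 : Matrix (σ × τ) (σ × τ) ℂ).submatrix e e = _
    rw [submatrix_one_equiv]
  map_star' A := by
    simp [star_eq_conjTranspose, conjTranspose_submatrix, conjTranspose_kronecker]

theorem tensorHom_apply (e : κ ≃ σ × τ) (A : Matrix σ σ ℂ) (k l : κ) :
    tensorHom e A k l = A (e k).1 (e l).1 * (1 : Matrix τ τ ℂ) (e k).2 (e l).2 := rfl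

theorem norm_tensorHom_le (e : κ ≃ σ × τ) (A : Matrix σ σ ℂ) : ‖tensorHom e A‖ ≤ ‖A‖ :=
  NonUnitalStarAlgHom.norm_apply_le (tensorHom e) A

theorem slice_tensorHom_mul (e : κ ≃ σ × τ) (A : Matrix σ σ ℂ) (M : Matrix κ κ ℂ) (p q : τ) :
    slice e (tensorHom e A * M) p q = A * slice e M p q := by
  ext i j
  simp only [slice, of_apply, mul_apply, tensorHom_apply]
  rw [← e.symm.sum_comp, Fintype.sum_prod_type]
  simp [one_apply]

theorem slice_mul_tensorHom (e : κ ≃ σ × τ) (A : Matrix σ σ ℂ) (M : Matrix κ κ ℂ) (p q : τ) :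
    slice e (M * tensorHom e A) p q = slice e M p q * A := by
  ext i j
  simp only [slice, of_apply, mul_apply, tensorHom_apply]
  rw [← e.symm.sum_comp, Fintype.sum_prod_type]
  simp [one_apply]

theorem tensorHom_commute (e : κ ≃ σ × τ) (A : Matrix σ σ ℂ) {M : Matrix κ κ ℂ}
    (hM : ∀ p q, ∃ c : ℂ, slice e M p q = c • 1) : Commute (tensorHom e A) M := by
  refine ext_slice e fun p q => ?_
  obtain ⟨c, hc⟩ := hM p q
  rw [slice_tensorHom_mul, slice_mul_tensorHom, hc]
  simp

theorem slice_lindbladMap (e : κ ≃ σ × τ) {ℓ : ℕ} (H : Matrix σ σ ℂ) (K : Fin ℓ → Matrix σ σ ℂ)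
    (M : Matrix κ κ ℂ) (p q : τ) :
    slice e (lindbladMap (tensorHom e H) (fun j => tensorHom e (K j)) M) p q
      = lindbladMap H K (slice e M p q) := by
  have hs : ∀ j, (tensorHom e (K j))ᴴ = tensorHom e (K j)ᴴ := fun j => (map_star _ _).symm
  have hsub : ∀ M N, slice e (M - N) p q = slice e M p q - slice e N p q := fun _ _ => rfl
  have hadd : ∀ M N, slice e (M + N) p q = slice e M p q + slice e N p q := fun _ _ => rfl
  have hsmul : ∀ (c : ℂ) N, slice e (c • N) p q = c • slice e N p q := fun _ _ => rfl
  have hsum : ∀ f : Fin ℓ → Matrix κ κ ℂ, slice e (∑ j, f j) p q = ∑ j, slice e (f j) p q := by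
    intro f
    ext i j
    simp [slice, Matrix.sum_apply]
  simp only [lindbladMap, hs, hsub, hadd, hsmul, hsum, mul_assoc, ← map_mul,
    slice_tensorHom_mul, slice_mul_tensorHom]

/-- Multiplication by `A ⊗ 1` acts block by block, so `Φ ⊗ id` has Lindblad form with `H ⊗ 1` and `K
j ⊗ 1`. Dissipativity, locality and commutation of the extended terms are all read off from this
form. -/
theorem tensorExt_eq_lindbladMap (e : κ ≃ σ × τ) {Φ : Matrix σ σ ℂ →ₗ[ℂ] Matrix σ σ ℂ} {ℓ : ℕ}
    {H : Matrix σ σ ℂ} {K : Fin ℓ → Matrix σ σ ℂ} (h : ∀ A, Φ A = lindbladMap H K A)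
    (M : Matrix κ κ ℂ) :
    tensorExt e Φ M = lindbladMap (tensorHom e H) (fun j => tensorHom e (K j)) M := by
  ext k l
  rw [apply_eq_slice e (lindbladMap _ _ M), slice_lindbladMap, ← h]
  rfl

theorem norm_lindbladMap_le {ℓ : ℕ} (H : Matrix κ κ ℂ) (K : Fin ℓ → Matrix κ κ ℂ)
    (A : Matrix κ κ ℂ) :
    ‖lindbladMap H K A‖ ≤ (2 * ‖H‖ + ∑ j, 2 * ‖K j‖ ^ 2) * ‖A‖ := by
  rw [add_mul, Finset.sum_mul]
  refine (norm_add_le _ _).trans (add_le_add ?_ ((norm_sum_le _ _).trans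
    (Finset.sum_le_sum fun j _ => ?_)))
  · rw [norm_smul, Complex.norm_I, one_mul]
    refine (norm_sub_le _ _).trans ?_
    linarith [norm_mul_le H A, norm_mul_le A H, mul_comm ‖A‖ ‖H‖]
  · have hk : ‖(K j)ᴴ‖ = ‖K j‖ := l2_opNorm_conjTranspose _
    have h0 : ‖(K j)ᴴ * K j‖ = ‖K j‖ ^ 2 := by rw [l2_opNorm_conjTranspose_mul_self, sq]
    have h1 : ‖(K j)ᴴ * A * K j‖ ≤ ‖K j‖ ^ 2 * ‖A‖ := by
      refine (norm_mul_le _ _).trans ?_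
      have := mul_le_mul_of_nonneg_right (norm_mul_le (K j)ᴴ A) (norm_nonneg (K j))
      rw [hk] at this
      linarith
    have h2 := norm_mul_le ((K j)ᴴ * K j) A
    have h3 := norm_mul_le A ((K j)ᴴ * K j)
    rw [h0] at h2 h3
    refine (norm_sub_le _ _).trans ?_
    rw [norm_smul]
    have h4 := norm_add_le ((K j)ᴴ * K j * A) (A * ((K j)ᴴ * K j))
    have h5 : ‖(1 / 2 : ℂ)‖ = 1 / 2 := by norm_num
    rw [h5]
    linarith

/-- A real supremum of an unbounded family is `0` by convention, so `cbNorm` dominates the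
ampliations only once a bound uniform in `n` is known; the Lindblad form supplies it. -/
theorem IsLindblad.bddAbove {Φ : Matrix σ σ ℂ →ₗ[ℂ] Matrix σ σ ℂ} (h : IsLindblad Φ) :
    BddAbove (Set.range fun n : ℕ => ‖LinearMap.toContinuousLinearMap (ampliation Φ n)‖) := by
  obtain ⟨H, -, ℓ, K, hΦ⟩ := h
  refine ⟨2 * ‖H‖ + ∑ j, 2 * ‖K j‖ ^ 2, ?_⟩
  rintro _ ⟨n, rfl⟩
  refine ContinuousLinearMap.opNorm_le_bound _ (by positivity) fun M => ?_
  change ‖ampliation Φ n M‖ ≤ _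
  rw [ampliation_apply_eq, tensorExt_eq_lindbladMap _ hΦ]
  refine (norm_lindbladMap_le _ _ _).trans (mul_le_mul_of_nonneg_right ?_ (norm_nonneg _))
  gcongr <;> exact norm_tensorHom_le _ _

/-- Reindexing as a star algebra homomorphism. -/
def reindexHom (e : κ ≃ σ) : Matrix σ σ ℂ →⋆ₐ[ℂ] Matrix κ κ ℂ where
  toFun A := A.submatrix e e
  map_one' := by simp
  map_mul' A B := by rw [submatrix_mul_equiv]
  map_zero' := rfl
  map_add' A B := rfl
  commutes' c := by
    rw [Algebra.algebraMap_eq_smul_one, Algebra.algebraMap_eq_smul_one]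
    change c • (1 : Matrix σ σ ℂ).submatrix e e = _
    rw [submatrix_one_equiv]
  map_star' A := rfl

theorem norm_submatrix_equiv_le (e : κ ≃ σ) (A : Matrix σ σ ℂ) : ‖A.submatrix e e‖ ≤ ‖A‖ :=
  NonUnitalStarAlgHom.norm_apply_le (reindexHom e) A

-- Enumerating `τ` identifies `Φ ⊗ id` with an ampliation, so the constant does not depend on the
-- surrounding volume.
omit [DecidableEq τ] in
theorem norm_tensorExt_le (e : κ ≃ σ × τ) {Φ : Matrix σ σ ℂ →ₗ[ℂ] Matrix σ σ ℂ}
    (h : IsLindblad Φ) (M : Matrix κ κ ℂ) : ‖tensorExt e Φ M‖ ≤ cbNorm Φ * ‖M‖ := by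
  set f := Fintype.equivFin τ
  set e' : κ ≃ σ × Fin (Fintype.card τ) := e.trans ((Equiv.refl σ).prodCongr f) with he'
  have h1 : tensorExt e Φ M
      = (ampliation Φ (Fintype.card τ) (M.submatrix e'.symm e'.symm)).submatrix e' e' := by
    ext k l
    have : slice e M (e k).2 (e l).2 = Matrix.of fun i j =>
        (M.submatrix e'.symm e'.symm) (i, (e' k).2) (j, (e' l).2) := by
      ext i j
      simp [slice, he']
    change Φ _ _ _ = Φ _ _ _
    rw [this]
    rfl
  rw [h1]
  refine (norm_submatrix_equiv_le _ _).trans ?_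
  refine ((LinearMap.toContinuousLinearMap (ampliation Φ (Fintype.card τ))).le_opNorm _).trans ?_
  refine mul_le_mul ?_ (norm_submatrix_equiv_le _ _) (norm_nonneg _) ?_
  · exact le_ciSup h.bddAbove (Fintype.card τ)
  · exact Real.iSup_nonneg fun n => norm_nonneg _

theorem cbNorm_nonneg (Φ : Matrix σ σ ℂ →ₗ[ℂ] Matrix σ σ ℂ) : 0 ≤ cbNorm Φ :=
  Real.iSup_nonneg fun _ => norm_nonneg _

theorem lindbladMap_one {ℓ : ℕ} (H : Matrix σ σ ℂ) (K : Fin ℓ → Matrix σ σ ℂ) :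
    lindbladMap H K 1 = 0 := by
  have : ∀ x : Matrix σ σ ℂ, x - (1 / 2 : ℂ) • (x + x) = 0 := fun x => by
    rw [← two_smul ℂ x, smul_smul]; norm_num
  simp only [lindbladMap, mul_one, one_mul, sub_self, smul_zero, this, Finset.sum_const_zero,
    add_zero]

theorem map_lindbladMap (f : Matrix σ σ ℂ →⋆ₐ[ℂ] Matrix κ κ ℂ) {ℓ : ℕ} (H : Matrix σ σ ℂ)
    (K : Fin ℓ → Matrix σ σ ℂ) (A : Matrix σ σ ℂ) :
    f (lindbladMap H K A) = lindbladMap (f H) (fun j => f (K j)) (f A) := by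
  have hs : ∀ j, (f (K j))ᴴ = f (K j)ᴴ := fun j => (map_star _ _).symm
  simp only [lindbladMap, hs, map_add, map_smul, map_sub, map_sum, map_mul]

-- `Ψ` is built from left and right multiplications by `H`, `K j` and `(K j)ᴴ`. With `φ` general,
-- this covers both multiplication by a distant operator and another local generator.
omit [DecidableEq κ] in
theorem commute_lindbladMap {φ Ψ : Module.End ℂ (Matrix κ κ ℂ)} {ℓ : ℕ} {H : Matrix κ κ ℂ}
    {K : Fin ℓ → Matrix κ κ ℂ} (hΨ : ∀ A, Ψ A = lindbladMap H K A) {M : Set (Matrix κ κ ℂ)}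
    (hH : H ∈ M) (hK : ∀ j, K j ∈ M) (hK' : ∀ j, (K j)ᴴ ∈ M)
    (hl : ∀ a ∈ M, ∀ A, φ (a * A) = a * φ A) (hr : ∀ a ∈ M, ∀ A, φ (A * a) = φ A * a)
    (A : Matrix κ κ ℂ) : φ (Ψ A) = Ψ (φ A) := by
  rw [hΨ, hΨ]
  simp only [lindbladMap, map_add, map_smul, map_sub, map_sum, mul_assoc]
  congr 1
  · rw [hl _ hH, hr _ hH]
  · refine Finset.sum_congr rfl fun j _ => ?_
    rw [hl _ (hK' j), hr _ (hK j), hl _ (hK' j), hl _ (hK j), ← mul_assoc A, hr _ (hK j),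
      hr _ (hK' j), mul_assoc]

end Tensor

/-! ### Local algebras and local generators -/

section Local

open Matrix

variable {Γ : Type*} {S : Γ → Type*}

/-- Configurations of `Λ \ X`. -/
abbrev OuterConfig (S : Γ → Type*) (X Λ : Finset Γ) : Type _ :=
  (x : {x : {x // x ∈ Λ} // (x : Γ) ∉ X}) → S x

variable [DecidableEq Γ]

/-- The splitting of configurations of `Λ` into configurations of `X` and of `Λ \ X`. -/
def configEquiv {X Λ : Finset Γ} (h : X ⊆ Λ) :
    Config S Λ ≃ Config S X × OuterConfig S X Λ where
  toFun σ := (restrict h σ, fun x => σ x)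
  invFun p := fun x => if hx : (x : Γ) ∈ X then p.1 ⟨x, hx⟩ else p.2 ⟨x, hx⟩
  left_inv σ := by
    ext x
    by_cases hx : (x : Γ) ∈ X <;> simp [hx, restrict]
  right_inv p := by
    refine Prod.ext ?_ ?_
    · ext x
      simp [restrict]
    · ext x
      simp [x.2]

theorem glue_eq {X Λ : Finset Γ} (h : X ⊆ Λ) (α : Config S X) (σ : Config S Λ) :
    glue α σ = (configEquiv h).symm (α, (configEquiv h σ).2) := by
  ext x
  by_cases hx : (x : Γ) ∈ X <;> simp [glue, configEquiv, hx]

variable [∀ x, Fintype (S x)] [∀ x, DecidableEq (S x)]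

theorem embed_eq {X Λ : Finset Γ} (h : X ⊆ Λ) (A : LocalAlg S X) :
    embed h A = tensorHom (configEquiv h) A := by
  ext σ τ
  have : (∀ x : {x // x ∈ Λ}, (x : Γ) ∉ X → σ x = τ x) ↔
      (configEquiv h σ).2 = (configEquiv h τ).2 :=
    ⟨fun H => funext fun x => H x.1 x.2, fun H x hx => congrFun H ⟨x, hx⟩⟩
  rw [tensorHom_apply, one_apply]
  simp only [embed, of_apply, this, mul_ite, mul_one, mul_zero]
  rfl

omit [∀ x, Fintype (S x)] [∀ x, DecidableEq (S x)] in
theorem extend_eq {Z Λ : Finset Γ} (h : Z ⊆ Λ) (Φ : LocalAlg S Z →ₗ[ℂ] LocalAlg S Z)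
    (M : LocalAlg S Λ) : extend h Φ M = tensorExt (configEquiv h) Φ M := by
  ext σ τ
  simp only [extend, glue_eq h]
  rfl

theorem embed_mul {X Λ : Finset Γ} (h : X ⊆ Λ) (A B : LocalAlg S X) :
    embed h (A * B) = embed h A * embed h B := by
  simp only [embed_eq, map_mul]

theorem norm_embed_le {X Λ : Finset Γ} (h : X ⊆ Λ) (A : LocalAlg S X) : ‖embed h A‖ ≤ ‖A‖ := by
  rw [embed_eq]
  exact norm_tensorHom_le _ _

omit [∀ x, Fintype (S x)] in
theorem embed_embed {X Y Λ : Finset Γ} (h : X ⊆ Y) (h' : Y ⊆ Λ) (A : LocalAlg S X) :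
    embed h' (embed h A) = embed (h.trans h') A := by
  ext σ τ
  simp only [embed, of_apply]
  have hiff : (∀ x : {x // x ∈ Λ}, (x : Γ) ∉ X → σ x = τ x) ↔
      (∀ x : {x // x ∈ Λ}, (x : Γ) ∉ Y → σ x = τ x) ∧
      (∀ x : {x // x ∈ Y}, (x : Γ) ∉ X → restrict h' σ x = restrict h' τ x) := by
    constructor
    · exact fun H => ⟨fun x hx => H x fun hx' => hx (h hx'), fun x hx => H ⟨x, h' x.2⟩ hx⟩
    · rintro ⟨H1, H2⟩ x hx
      by_cases hy : (x : Γ) ∈ Y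
      · exact H2 ⟨x, hy⟩ hx
      · exact H1 x hy
  by_cases h1 : ∀ x : {x // x ∈ Λ}, (x : Γ) ∉ Y → σ x = τ x
  · by_cases h2 : ∀ x : {x // x ∈ Y}, (x : Γ) ∉ X → restrict h' σ x = restrict h' τ x
    · rw [if_pos h1, if_pos h2, if_pos (hiff.2 ⟨h1, h2⟩)]
      rfl
    · rw [if_pos h1, if_neg h2, if_neg fun H => h2 (hiff.1 H).2]
  · rw [if_neg h1, if_neg fun H => h1 (hiff.1 H).1]

/-- The operators of `𝓐_Λ` supported in `X`. -/
def supported (S : Γ → Type*) [∀ x, Fintype (S x)] [∀ x, DecidableEq (S x)] {X Λ : Finset Γ}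
    (h : X ⊆ Λ) : Submodule ℂ (LocalAlg S Λ) :=
  LinearMap.range (tensorHom (configEquiv (S := S) h)).toAlgHom.toLinearMap

theorem mem_supported {X Λ : Finset Γ} {h : X ⊆ Λ} {M : LocalAlg S Λ} :
    M ∈ supported S h ↔ ∃ A, embed h A = M := by
  simp only [embed_eq]
  exact Iff.rfl

theorem embed_mem_supported {X Y Λ : Finset Γ} (h : X ⊆ Y) (hX : X ⊆ Λ) (hY : Y ⊆ Λ)
    (A : LocalAlg S X) : embed hX A ∈ supported S hY :=
  mem_supported.2 ⟨embed h A, embed_embed h hY A⟩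

theorem mul_mem_supported {X Λ : Finset Γ} {h : X ⊆ Λ} {M N : LocalAlg S Λ}
    (hM : M ∈ supported S h) (hN : N ∈ supported S h) : M * N ∈ supported S h := by
  obtain ⟨A, rfl⟩ := mem_supported.1 hM
  obtain ⟨B, rfl⟩ := mem_supported.1 hN
  exact mem_supported.2 ⟨A * B, embed_mul h A B⟩

theorem isClosed_supported {X Λ : Finset Γ} (h : X ⊆ Λ) :
    IsClosed (supported S h : Set (LocalAlg S Λ)) :=
  Submodule.closed_of_finiteDimensional _

theorem embed_commute [∀ x, Nonempty (S x)] {X Z Λ : Finset Γ} (hX : X ⊆ Λ) (hZ : Z ⊆ Λ)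
    (hd : Disjoint X Z) (A : LocalAlg S X) (B : LocalAlg S Z) :
    Commute (embed hX A) (embed hZ B) := by
  rw [embed_eq hX]
  refine tensorHom_commute _ _ fun p q => ?_
  -- Off-`X` operators have scalar slices; the scalar is read at one reference configuration, whose
  -- choice does not matter.
  have i₀ : Config S X := Classical.arbitrary _
  refine ⟨slice (configEquiv hX) (embed hZ B) p q i₀ i₀, ?_⟩
  have hin : ∀ (x : {x // x ∈ Λ}) (hx : (x : Γ) ∈ X) (i : Config S X) (p : OuterConfig S X Λ),
      (configEquiv hX).symm (i, p) x = i ⟨x, hx⟩ := fun x hx i p => by simp [configEquiv, hx]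
  have hout : ∀ (x : {x // x ∈ Λ}) (hx : (x : Γ) ∉ X) (i : Config S X) (p : OuterConfig S X Λ),
      (configEquiv hX).symm (i, p) x = p ⟨x, hx⟩ := fun x hx i p => by simp [configEquiv, hx]
  have hres : ∀ (i j : Config S X) (p : OuterConfig S X Λ),
      restrict hZ ((configEquiv hX).symm (i, p)) = restrict hZ ((configEquiv hX).symm (j, p)) := by
    intro i j p
    ext x
    have hx : (x : Γ) ∉ X := fun hx => Finset.disjoint_left.1 hd hx x.2
    simp only [restrict, hout ⟨x, hZ x.2⟩ hx]
  ext i j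
  rw [Matrix.smul_apply, one_apply]
  by_cases hij : i = j
  · subst hij
    simp only [slice, embed, of_apply, smul_eq_mul, if_true, mul_one]
    rw [hres i i₀ p, hres i i₀ q]
    congr 1
    refine propext (forall_congr' fun x => imp_congr_right fun _ => ?_)
    by_cases hx : (x : Γ) ∈ X
    · simp only [hin x hx]
    · simp only [hout x hx]
  · rw [if_neg hij, smul_zero]
    simp only [slice, embed, of_apply]
    refine if_neg fun H => hij ?_
    ext x
    have hx : (x : Γ) ∉ Z := fun hz => Finset.disjoint_left.1 hd x.2 hz
    have := H ⟨x, hX x.2⟩ hx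
    rwa [hin _ x.2, hin _ x.2] at this

theorem commute_of_mem_supported [∀ x, Nonempty (S x)] {X Z Λ : Finset Γ} {hX : X ⊆ Λ}
    {hZ : Z ⊆ Λ} (hd : Disjoint X Z) {M N : LocalAlg S Λ} (hM : M ∈ supported S hX)
    (hN : N ∈ supported S hZ) : Commute M N := by
  obtain ⟨A, rfl⟩ := mem_supported.1 hM
  obtain ⟨B, rfl⟩ := mem_supported.1 hN
  exact embed_commute hX hZ hd A B

/-- Diagonal vector states are product states. -/
theorem diagState_mul {X Y Λ : Finset Γ} {hX : X ⊆ Λ} {hY : Y ⊆ Λ} (hd : Disjoint X Y)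
    (σ : Config S Λ) {M N : LocalAlg S Λ} (hM : M ∈ supported S hX) (hN : N ∈ supported S hY) :
    diagState σ (M * N) = diagState σ M * diagState σ N := by
  obtain ⟨A, rfl⟩ := mem_supported.1 hM
  obtain ⟨B, rfl⟩ := mem_supported.1 hN
  change (embed hX A * embed hY B) σ σ = embed hX A σ σ * embed hY B σ σ
  rw [mul_apply]
  -- A nonzero entry of the first factor forces `ρ = σ` off `X`, one of the second forces it off
  -- `Y`; as `X` and `Y` are disjoint, this is all of `Λ`.
  refine Finset.sum_eq_single σ (fun ρ _ hρ => ?_) (by simp)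
  by_contra hne
  refine hρ ?_
  simp only [embed, of_apply, ite_mul, mul_ite, zero_mul, mul_zero] at hne
  ext x
  by_cases hx : (x : Γ) ∈ X
  · have hy : (x : Γ) ∉ Y := Finset.disjoint_left.1 hd hx
    by_contra hx'
    exact hne (by rw [if_neg fun H => hx' (H x hy)])
  · by_contra hx'
    refine hne ?_
    have : ¬ ∀ x : {x // x ∈ Λ}, (x : Γ) ∉ X → σ x = ρ x := fun H => hx' (H x hx).symm
    rw [if_neg this, ite_self]

/-! #### Local generators -/

variable (𝓛 : Interaction S)

theorem extend_L_eq {Z Λ : Finset Γ} (h : Z ⊆ Λ) :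
    ∃ H : LocalAlg S Z, H.IsHermitian ∧ ∃ (ℓ : ℕ) (K : Fin ℓ → LocalAlg S Z),
      ∀ M, extend h (𝓛.L Z) M = lindbladMap (embed h H) (fun j => embed h (K j)) M := by
  obtain ⟨H, hH, ℓ, K, hΦ⟩ := 𝓛.lindblad Z
  refine ⟨H, hH, ℓ, K, fun M => ?_⟩
  simp only [extend_eq, embed_eq]
  exact tensorExt_eq_lindbladMap _ hΦ M

theorem conjTranspose_embed {X Λ : Finset Γ} (h : X ⊆ Λ) (A : LocalAlg S X) :
    (embed h A)ᴴ = embed h Aᴴ := by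
  simp only [embed_eq]
  exact (map_star (tensorHom _) A).symm

theorem isLindblad_extend {Z Λ : Finset Γ} (h : Z ⊆ Λ) : IsLindblad (extend h (𝓛.L Z)) := by
  obtain ⟨H, hH, ℓ, K, hΦ⟩ := extend_L_eq 𝓛 h
  refine ⟨embed h H, ?_, ℓ, fun j => embed h (K j), hΦ⟩
  rw [IsHermitian, conjTranspose_embed, hH.eq]

theorem norm_extend_le {Z Λ : Finset Γ} (h : Z ⊆ Λ) (M : LocalAlg S Λ) :
    ‖extend h (𝓛.L Z) M‖ ≤ cbNorm (𝓛.L Z) * ‖M‖ := by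
  rw [extend_eq]
  exact norm_tensorExt_le _ (𝓛.lindblad Z) M

theorem extend_commute {Z Λ : Finset Γ} (h : Z ⊆ Λ) {φ : Module.End ℂ (LocalAlg S Λ)}
    (hl : ∀ a ∈ supported S h, ∀ M, φ (a * M) = a * φ M)
    (hr : ∀ a ∈ supported S h, ∀ M, φ (M * a) = φ M * a) (M : LocalAlg S Λ) :
    φ (extend h (𝓛.L Z) M) = extend h (𝓛.L Z) (φ M) := by
  obtain ⟨H, hH, ℓ, K, hΦ⟩ := extend_L_eq 𝓛 h
  have hm : ∀ A, embed h A ∈ supported S h := fun A => mem_supported.2 ⟨A, rfl⟩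
  exact commute_lindbladMap hΦ (hm H) (fun j => hm (K j))
    (fun j => by rw [conjTranspose_embed]; exact hm _) hl hr M

variable [∀ x, Nonempty (S x)]

theorem extend_mul_right {Z X Λ : Finset Γ} (h : Z ⊆ Λ) {hX : X ⊆ Λ} (hd : Disjoint Z X)
    {N : LocalAlg S Λ} (hN : N ∈ supported S hX) (M : LocalAlg S Λ) :
    extend h (𝓛.L Z) (M * N) = extend h (𝓛.L Z) M * N :=
  (extend_commute 𝓛 h (φ := LinearMap.mulRight ℂ N) (fun a _ M => by simp [mul_assoc])
    (fun a ha M => by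
      simp only [LinearMap.mulRight_apply, mul_assoc, (commute_of_mem_supported hd ha hN).eq])
    M).symm

theorem extend_mul_left {Z X Λ : Finset Γ} (h : Z ⊆ Λ) {hX : X ⊆ Λ} (hd : Disjoint Z X)
    {N : LocalAlg S Λ} (hN : N ∈ supported S hX) (M : LocalAlg S Λ) :
    extend h (𝓛.L Z) (N * M) = N * extend h (𝓛.L Z) M :=
  (extend_commute 𝓛 h (φ := LinearMap.mulLeft ℂ N)
    (fun a ha M => by
      simp only [LinearMap.mulLeft_apply, ← mul_assoc, (commute_of_mem_supported hd ha hN).eq])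
    (fun a _ M => by simp [mul_assoc]) M).symm

/-- `L(N · 1) = N L(1)`, and Lindblad maps annihilate the identity. -/
theorem extend_eq_zero {Z X Λ : Finset Γ} (h : Z ⊆ Λ) {hX : X ⊆ Λ} (hd : Disjoint Z X)
    {N : LocalAlg S Λ} (hN : N ∈ supported S hX) : extend h (𝓛.L Z) N = 0 := by
  obtain ⟨H, hH, ℓ, K, hΦ⟩ := extend_L_eq 𝓛 h
  rw [← mul_one N, extend_mul_left 𝓛 h hd hN, hΦ, lindbladMap_one, mul_zero]

theorem extend_extend_comm {Z Z' Λ : Finset Γ} (h : Z ⊆ Λ) (h' : Z' ⊆ Λ) (hd : Disjoint Z Z')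
    (M : LocalAlg S Λ) :
    extend h (𝓛.L Z) (extend h' (𝓛.L Z') M) = extend h' (𝓛.L Z') (extend h (𝓛.L Z) M) :=
  extend_commute 𝓛 h' (fun _ ha => extend_mul_left 𝓛 h hd ha)
    (fun _ ha => extend_mul_right 𝓛 h hd ha) M

omit [∀ x, Nonempty (S x)] in
theorem extend_mem_supported {Z X Λ : Finset Γ} (h : Z ⊆ Λ) {hX : X ⊆ Λ} (hZX : Z ⊆ X)
    {N : LocalAlg S Λ} (hN : N ∈ supported S hX) : extend h (𝓛.L Z) N ∈ supported S hX := by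
  obtain ⟨H, hH, ℓ, K, hΦ⟩ := extend_L_eq 𝓛 h
  obtain ⟨A, rfl⟩ := mem_supported.1 hN
  refine mem_supported.2 ⟨lindbladMap (embed hZX H) (fun j => embed hZX (K j)) A, ?_⟩
  rw [hΦ, embed_eq hX, map_lindbladMap]
  simp only [← embed_eq hX, embed_embed]

/-- The generator consisting of the interaction terms indexed by a family of subsets of `Λ`. -/
def partialGenerator (Λ : Finset Γ) (s : Finset {Z // Z ∈ Λ.powerset}) :
    LocalAlg S Λ →ₗ[ℂ] LocalAlg S Λ :=
  ∑ Z ∈ s, extend (Finset.mem_powerset.1 Z.2) (𝓛.L Z)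

omit [∀ x, Nonempty (S x)] in
theorem isDissipative_partialGenerator (Λ : Finset Γ) (s : Finset {Z // Z ∈ Λ.powerset}) :
    IsDissipative (LinearMap.toContinuousLinearMap (partialGenerator 𝓛 Λ s)) :=
  (IsNormDecreasing.sum s fun Z _ =>
    (isLindblad_extend 𝓛 (Finset.mem_powerset.1 Z.2)).isNormDecreasing).isDissipative

end Local

/-! ### Lieb-Robinson bounds -/

section LiebRobinson

variable {Γ : Type*} [DecidableEq Γ]

/-- The spatial factor in the Lieb-Robinson bound for an observable supported in `W` and an
interaction term supported in `Z`. -/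
def reach (f : Γ → Γ → ℝ) (W Z : Finset Γ) (e : ℝ) : ℝ :=
  ∑ w ∈ W, ((if w ∈ Z then 1 else 0) + e * ∑ z ∈ Z, f z w)

theorem reach_nonneg {f : Γ → Γ → ℝ} (hf : ∀ x y, 0 ≤ f x y) (W Z : Finset Γ) {e : ℝ}
    (he : 0 ≤ e) : 0 ≤ reach f W Z e :=
  Finset.sum_nonneg fun _ _ => add_nonneg (by split_ifs <;> norm_num)
    (mul_nonneg he (Finset.sum_nonneg fun _ _ => hf _ _))

theorem one_le_sum_indicator {R Z : Finset Γ} (h : ∃ y ∈ R, y ∈ Z) :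
    (1 : ℝ) ≤ ∑ y ∈ R, if y ∈ Z then 1 else 0 := by
  obtain ⟨y, hy, hyZ⟩ := h
  have := Finset.single_le_sum (f := fun y => if y ∈ Z then (1 : ℝ) else 0)
    (fun i _ => by split_ifs <;> norm_num) hy
  simpa [hyZ] using this

/-- Why `reach` closes the Lieb-Robinson iteration. Inserting the indicator sum over `R w`, which is
at least one, leaves sums over sets containing two given points, and the convolution bound returns
`f y w` with factor `M(1 + Ce)`. For `e = (exp(MCt) - 1)/C` this factor is `M exp(MCt)`, the
derivative of `e`. The set `R w` is the support `Z` in the iteration and the far points in the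
truncation estimate. -/
theorem sum_mul_reach_le {ι : Type*} {s : Finset ι} {c : ι → ℝ} {Z : ι → Finset Γ}
    {Λ W : Finset Γ} {f : Γ → Γ → ℝ} {M C e : ℝ} {R : Γ → Finset Γ}
    (hc : ∀ i, 0 ≤ c i) (hf : ∀ x y, 0 ≤ f x y) (hM : 0 ≤ M) (he : 0 ≤ e)
    (hZ : ∀ i ∈ s, Z i ⊆ Λ)
    (hβ : ∀ x y, ∑ i ∈ s, (if x ∈ Z i ∧ y ∈ Z i then c i else 0) ≤ M * f x y)
    (hconv : ∀ x y, ∑ z ∈ Λ, f x z * f z y ≤ C * f x y)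
    (hR : ∀ i ∈ s, ∀ w ∈ W, ∃ y ∈ R w, y ∈ Z i) :
    ∑ i ∈ s, c i * reach f W (Z i) e ≤ M * (1 + C * e) * ∑ w ∈ W, ∑ y ∈ R w, f y w := by
  simp only [reach, Finset.mul_sum]
  rw [Finset.sum_comm]
  refine Finset.sum_le_sum fun w hw => ?_
  calc ∑ i ∈ s, c i * ((if w ∈ Z i then 1 else 0) + ∑ z ∈ Z i, e * f z w)
      ≤ ∑ i ∈ s, ∑ y ∈ R w, ((if y ∈ Z i ∧ w ∈ Z i then c i else 0) +
          ∑ z ∈ Λ, e * f z w * (if y ∈ Z i ∧ z ∈ Z i then c i else 0)) := by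
        refine Finset.sum_le_sum fun i hi => ?_
        have h0 : 0 ≤ c i * ((if w ∈ Z i then 1 else 0) + ∑ z ∈ Z i, e * f z w) :=
          mul_nonneg (hc i) (add_nonneg (by split_ifs <;> norm_num)
            (Finset.sum_nonneg fun _ _ => mul_nonneg he (hf _ _)))
        refine (le_mul_of_one_le_left h0 (one_le_sum_indicator (hR i hi w hw))).trans_eq ?_
        rw [Finset.sum_mul]
        refine Finset.sum_congr rfl fun y _ => ?_
        by_cases hy : y ∈ Z i
        · simp only [hy, true_and, if_true, one_mul, mul_add, mul_ite, mul_one, mul_zero]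
          congr 1
          rw [← Finset.sum_filter, Finset.filter_mem_eq_inter, Finset.inter_eq_right.2 (hZ i hi),
            Finset.mul_sum]
          exact Finset.sum_congr rfl fun _ _ => mul_comm _ _
        · simp [hy]
    _ = ∑ y ∈ R w, ((∑ i ∈ s, if y ∈ Z i ∧ w ∈ Z i then c i else 0) +
          ∑ z ∈ Λ, e * f z w * ∑ i ∈ s, if y ∈ Z i ∧ z ∈ Z i then c i else 0) := by
        rw [Finset.sum_comm]
        refine Finset.sum_congr rfl fun y _ => ?_
        rw [Finset.sum_add_distrib]
        congr 1
        rw [Finset.sum_comm]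
        exact Finset.sum_congr rfl fun z _ => (Finset.mul_sum _ _ _).symm
    _ ≤ ∑ y ∈ R w, M * (1 + C * e) * f y w := by
        refine Finset.sum_le_sum fun y _ => ?_
        have h1 : ∑ z ∈ Λ, e * f z w * ∑ i ∈ s, (if y ∈ Z i ∧ z ∈ Z i then c i else 0)
            ≤ ∑ z ∈ Λ, e * M * (f y z * f z w) := by
          refine Finset.sum_le_sum fun z _ => ?_
          refine (mul_le_mul_of_nonneg_left (hβ y z) (mul_nonneg he (hf _ _))).trans_eq ?_
          ring
        rw [← Finset.mul_sum] at h1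
        have h2 := mul_le_mul_of_nonneg_left (hconv y w) (mul_nonneg he hM)
        linarith [hβ y w]

variable {S : Γ → Type*} [∀ x, Fintype (S x)] [∀ x, DecidableEq (S x)]

/-- Bounds on the interaction strength in a finite volume, in terms of a decay function `f`. -/
structure IsDecayBound (𝓛 : Interaction S) (Λ : Finset Γ) (f : Γ → Γ → ℝ) (M C : ℝ) : Prop where
  nonneg : ∀ x y, 0 ≤ f x y
  pos_M : 0 < M
  pos_C : 0 < C
  sum_le : ∀ x y, ∑ Z : {Z // Z ∈ Λ.powerset},
    (if x ∈ Z.1 ∧ y ∈ Z.1 then cbNorm (𝓛.L Z.1) else 0) ≤ M * f x y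
  conv : ∀ x y, ∑ z ∈ Λ, f x z * f z y ≤ C * f x y

variable {𝓛 : Interaction S} {Λ : Finset Γ} {f : Γ → Γ → ℝ} {M C : ℝ}

theorem IsDecayBound.sum_mul_reach_le (h : IsDecayBound 𝓛 Λ f M C)
    (s : Finset {Z // Z ∈ Λ.powerset}) {W : Finset Γ} {R : Γ → Finset Γ}
    (hR : ∀ Z ∈ s, ∀ w ∈ W, ∃ y ∈ R w, y ∈ Z.1) {t : ℝ} (ht : 0 ≤ t) :
    ∑ Z ∈ s, cbNorm (𝓛.L Z.1) * reach f W Z.1 ((Real.exp (M * C * t) - 1) / C) ≤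
      M * Real.exp (M * C * t) * ∑ w ∈ W, ∑ y ∈ R w, f y w := by
  have hC := h.pos_C
  have he : 0 ≤ (Real.exp (M * C * t) - 1) / C :=
    div_nonneg (sub_nonneg.2 (Real.one_le_exp
      (mul_nonneg (mul_nonneg h.pos_M.le hC.le) ht))) hC.le
  have := OpenSpin.sum_mul_reach_le (s := s) (c := fun Z => cbNorm (𝓛.L Z.1)) (Z := fun Z => Z.1)
    (Λ := Λ) (W := W) (C := C) (fun Z => cbNorm_nonneg _) h.nonneg h.pos_M.le he
    (fun Z _ => Finset.mem_powerset.1 Z.2)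
    (fun x y => (Finset.sum_le_sum_of_subset_of_nonneg (Finset.subset_univ s)
      fun Z _ _ => by split_ifs <;> [exact cbNorm_nonneg _; exact le_rfl]).trans (h.sum_le x y))
    h.conv hR
  rwa [mul_div_cancel₀ _ hC.ne', add_sub_cancel] at this

/-- The semigroup generated by a subfamily of the interaction terms. -/
abbrev partialDynamics (𝓛 : Interaction S) (Λ : Finset Γ) (s : Finset {Z // Z ∈ Λ.powerset})
    (t : ℝ) : LocalAlg S Λ →L[ℂ] LocalAlg S Λ :=
  semigroup (LinearMap.toContinuousLinearMap (partialGenerator 𝓛 Λ s)) t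

theorem norm_partialGenerator_apply_le (s : Finset {Z // Z ∈ Λ.powerset}) (A : LocalAlg S Λ) :
    ‖partialGenerator 𝓛 Λ s A‖ ≤
      ∑ Z ∈ s, ‖extend (Finset.mem_powerset.1 Z.2) (𝓛.L Z.1) A‖ := by
  rw [partialGenerator, LinearMap.sum_apply]
  exact norm_sum_le _ _

variable [∀ x, Nonempty (S x)]

/-- The spatial term is reproduced at each iteration, so only the remainder changes: it starts from
the trivial contraction bound, and each time integration raises it to the next term of the
exponential series. In finite volume the total strength is finite, so the remainder vanishes in the
limit. -/
theorem lieb_robinson_step (h : IsDecayBound 𝓛 Λ f M C) (s : Finset {Z // Z ∈ Λ.powerset})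
    {W : Finset Γ} {hW : W ⊆ Λ} {A : LocalAlg S Λ} (hA : A ∈ supported S hW) (n : ℕ) :
    ∀ (Z : {Z // Z ∈ Λ.powerset}) (t : ℝ), 0 ≤ t →
      ‖extend (Finset.mem_powerset.1 Z.2) (𝓛.L Z.1) (partialDynamics 𝓛 Λ s t A)‖ ≤
        cbNorm (𝓛.L Z.1) * ‖A‖ * (reach f W Z.1 ((Real.exp (M * C * t) - 1) / C) +
          ((∑ Z ∈ s, cbNorm (𝓛.L Z.1)) * t) ^ n / n.factorial) := by
  set κ := ∑ Z ∈ s, cbNorm (𝓛.L Z.1) with hκ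
  have hC := h.pos_C
  have hM := h.pos_M
  have he : ∀ t, 0 ≤ t → 0 ≤ (Real.exp (M * C * t) - 1) / C := fun t ht =>
    div_nonneg (sub_nonneg.2 (Real.one_le_exp (mul_nonneg (mul_nonneg hM.le hC.le) ht))) hC.le
  induction n with
  | zero =>
    intro Z t ht
    refine (norm_extend_le 𝓛 _ _).trans ?_
    rw [mul_assoc]
    refine mul_le_mul_of_nonneg_left ?_ (cbNorm_nonneg _)
    refine (norm_semigroup_le (isDissipative_partialGenerator 𝓛 Λ s) ht A).trans ?_
    refine le_mul_of_one_le_right (norm_nonneg _) ?_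
    simpa using reach_nonneg h.nonneg W Z.1 (he t ht)
  | succ n ih =>
    intro Z t ht
    set K := extend (Finset.mem_powerset.1 Z.2) (𝓛.L Z.1) with hK
    -- Terms disjoint from `Z` commute with `L_Z` and cost nothing; only those meeting `Z` enter the
    -- source.
    set s₁ := s.filter fun Z' => Disjoint Z.1 Z'.1 with hs₁
    set s₂ := s.filter fun Z' => ¬ Disjoint Z.1 Z'.1 with hs₂
    set q := ∑ w ∈ W, ∑ z ∈ Z.1, f z w with hq
    have hsplit : LinearMap.toContinuousLinearMap (partialGenerator 𝓛 Λ s)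
        = LinearMap.toContinuousLinearMap (partialGenerator 𝓛 Λ s₁)
          + LinearMap.toContinuousLinearMap (partialGenerator 𝓛 Λ s₂) := by
      rw [← map_add]
      congr 1
      exact (Finset.sum_filter_add_sum_filter_not s _ _).symm
    have hcomm : ∀ x, (LinearMap.toContinuousLinearMap K)
        (LinearMap.toContinuousLinearMap (partialGenerator 𝓛 Λ s₁) x)
        = LinearMap.toContinuousLinearMap (partialGenerator 𝓛 Λ s₁)
          (LinearMap.toContinuousLinearMap K x) := by
      intro x
      change K (partialGenerator 𝓛 Λ s₁ x) = partialGenerator 𝓛 Λ s₁ (K x)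
      rw [partialGenerator, LinearMap.sum_apply, LinearMap.sum_apply, map_sum]
      exact Finset.sum_congr rfl fun Z' hZ' =>
        extend_extend_comm 𝓛 _ _ (Finset.mem_filter.1 hZ').2 x
    have hderiv : ∀ r, HasDerivAt
        (fun r => cbNorm (𝓛.L Z.1) * ‖A‖ * (q * ((Real.exp (M * C * r) - 1) / C)
          + (κ * r) ^ (n + 1) / (n + 1).factorial))
        (cbNorm (𝓛.L Z.1) * ‖A‖ * (M * Real.exp (M * C * r) * q
          + κ * ((κ * r) ^ n / n.factorial))) r := by
      intro r
      have h1 : HasDerivAt (fun r => Real.exp (M * C * r))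
          (Real.exp (M * C * r) * (M * C)) r := by
        simpa using ((hasDerivAt_id r).const_mul (M * C)).exp
      have h2 : HasDerivAt (fun r : ℝ => (κ * r) ^ (n + 1))
          ((n + 1 : ℕ) * (κ * r) ^ n * κ) r := by
        simpa using! ((hasDerivAt_id r).const_mul κ).pow (n + 1)
      have h3 := ((((h1.sub_const 1).div_const C).const_mul q).add
        (h2.div_const ((n + 1).factorial : ℝ))).const_mul (cbNorm (𝓛.L Z.1) * ‖A‖)
      refine h3.congr_deriv ?_
      rw [Nat.factorial_succ]
      push_cast
      have : (n.factorial : ℝ) ≠ 0 := by positivity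
      have : (n : ℝ) + 1 ≠ 0 := by positivity
      field_simp
    have hρ : ∀ r, 0 ≤ r → ‖K (partialGenerator 𝓛 Λ s₂ (partialDynamics 𝓛 Λ s r A))‖ ≤
        cbNorm (𝓛.L Z.1) * ‖A‖ * (M * Real.exp (M * C * r) * q
          + κ * ((κ * r) ^ n / n.factorial)) := by
      intro r hr
      have hκr : 0 ≤ (κ * r) ^ n / n.factorial := by
        have : 0 ≤ κ := Finset.sum_nonneg fun _ _ => cbNorm_nonneg _
        positivity
      refine (norm_extend_le 𝓛 _ _).trans ?_
      rw [mul_assoc]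
      refine mul_le_mul_of_nonneg_left ?_ (cbNorm_nonneg _)
      refine (norm_partialGenerator_apply_le _ _).trans ?_
      refine (Finset.sum_le_sum fun Z' _ => ih Z' r hr).trans ?_
      have h1 := h.sum_mul_reach_le s₂ (W := W) (R := fun _ => Z.1)
        (fun Z' hZ' w _ => Finset.not_disjoint_iff.1 (Finset.mem_filter.1 hZ').2) hr
      have h2 : ∑ Z' ∈ s₂, cbNorm (𝓛.L Z'.1) ≤ κ :=
        Finset.sum_le_sum_of_subset_of_nonneg (Finset.filter_subset _ _)
          fun _ _ _ => cbNorm_nonneg _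
      calc _ = ‖A‖ * (∑ Z' ∈ s₂, cbNorm (𝓛.L Z'.1) *
              reach f W Z'.1 ((Real.exp (M * C * r) - 1) / C)
            + (∑ Z' ∈ s₂, cbNorm (𝓛.L Z'.1)) * ((κ * r) ^ n / n.factorial)) := by
            rw [Finset.sum_mul s₂, ← Finset.sum_add_distrib, Finset.mul_sum]
            exact Finset.sum_congr rfl fun _ _ => by ring
        _ ≤ _ := mul_le_mul_of_nonneg_left
            (add_le_add h1 (mul_le_mul_of_nonneg_right h2 hκr)) (norm_nonneg _)
    have key := norm_apply_semigroup_le (K := LinearMap.toContinuousLinearMap K) hsplit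
      (isDissipative_partialGenerator 𝓛 Λ s₁) hcomm A ht hderiv hρ
    refine key.trans ?_
    -- The initial value vanishes unless `Z` meets `W`; this produces the indicator part of `reach`.
    have h0 : ‖K A‖ ≤ cbNorm (𝓛.L Z.1) * ‖A‖ * ∑ w ∈ W, (if w ∈ Z.1 then 1 else 0) := by
      by_cases hd : Disjoint Z.1 W
      · rw [hK, extend_eq_zero 𝓛 _ hd hA, norm_zero]
        exact mul_nonneg (mul_nonneg (cbNorm_nonneg _) (norm_nonneg _))
          (Finset.sum_nonneg fun _ _ => by split_ifs <;> norm_num)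
      · refine (norm_extend_le 𝓛 _ _).trans (le_mul_of_one_le_right
          (mul_nonneg (cbNorm_nonneg _) (norm_nonneg _)) (one_le_sum_indicator ?_))
        obtain ⟨y, h1, h2⟩ := Finset.not_disjoint_iff.1 hd
        exact ⟨y, h2, h1⟩
    have hreach : reach f W Z.1 ((Real.exp (M * C * t) - 1) / C)
        = ∑ w ∈ W, (if w ∈ Z.1 then 1 else 0) + q * ((Real.exp (M * C * t) - 1) / C) := by
      rw [reach, Finset.sum_add_distrib, ← Finset.mul_sum, mul_comm q]
    rw [hreach]
    change ‖K A‖ + _ ≤ _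
    simp only [mul_zero, Real.exp_zero, sub_self, zero_div, ne_eq, Nat.succ_ne_zero,
      not_false_eq_true, zero_pow, add_zero, sub_zero]
    linarith

/-- Lieb-Robinson bound: the effect of an interaction term on an evolved local observable. -/
theorem lieb_robinson (h : IsDecayBound 𝓛 Λ f M C) (s : Finset {Z // Z ∈ Λ.powerset})
    {W : Finset Γ} {hW : W ⊆ Λ} {A : LocalAlg S Λ} (hA : A ∈ supported S hW)
    (Z : {Z // Z ∈ Λ.powerset}) {t : ℝ} (ht : 0 ≤ t) :
    ‖extend (Finset.mem_powerset.1 Z.2) (𝓛.L Z.1) (partialDynamics 𝓛 Λ s t A)‖ ≤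
      cbNorm (𝓛.L Z.1) * ‖A‖ * reach f W Z.1 ((Real.exp (M * C * t) - 1) / C) := by
  have hlim := ((FloorSemiring.tendsto_pow_div_factorial_atTop
    ((∑ Z ∈ s, cbNorm (𝓛.L Z.1)) * t)).const_add
      (reach f W Z.1 ((Real.exp (M * C * t) - 1) / C))).const_mul (cbNorm (𝓛.L Z.1) * ‖A‖)
  rw [add_zero] at hlim
  exact ge_of_tendsto' hlim fun n => lieb_robinson_step h s hA n Z t ht

/-- Removing interaction terms that reach far from the support of an observable changes its
evolution only a little. -/
theorem norm_partialDynamics_sub_le (h : IsDecayBound 𝓛 Λ f M C)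
    (s : Finset {Z // Z ∈ Λ.powerset}) {W : Finset Γ} {hW : W ⊆ Λ} {A : LocalAlg S Λ}
    (hA : A ∈ supported S hW) {R : Γ → Finset Γ}
    (hR : ∀ Z ∉ s, ∀ w ∈ W, ∃ y ∈ R w, y ∈ Z.1) {t : ℝ} (ht : 0 ≤ t) :
    ‖partialDynamics 𝓛 Λ Finset.univ t A - partialDynamics 𝓛 Λ s t A‖ ≤
      ‖A‖ * ((Real.exp (M * C * t) - 1) / C * ∑ w ∈ W, ∑ y ∈ R w, f y w) := by
  set G := ∑ w ∈ W, ∑ y ∈ R w, f y w with hG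
  have hC := h.pos_C
  have hderiv : ∀ r, HasDerivAt (fun r => ‖A‖ * (Real.exp (M * C * r) / C * G))
      (‖A‖ * (M * Real.exp (M * C * r) * G)) r := by
    intro r
    have h1 : HasDerivAt (fun r => Real.exp (M * C * r))
        (Real.exp (M * C * r) * (M * C)) r := by
      simpa using ((hasDerivAt_id r).const_mul (M * C)).exp
    refine (((h1.div_const C).mul_const G).const_mul ‖A‖).congr_deriv ?_
    field_simp
  have key := norm_semigroup_sub_semigroup_le
    (D' := LinearMap.toContinuousLinearMap (partialGenerator 𝓛 Λ s))
    (isDissipative_partialGenerator 𝓛 Λ Finset.univ) A ht hderiv fun r hr => ?_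
  · refine key.trans_eq ?_
    simp only [mul_zero, Real.exp_zero]
    ring
  · have hsub : partialGenerator 𝓛 Λ Finset.univ - partialGenerator 𝓛 Λ s
        = partialGenerator 𝓛 Λ sᶜ := by
      rw [sub_eq_iff_eq_add, add_comm]
      exact (Finset.sum_add_sum_compl s _).symm
    change ‖partialGenerator 𝓛 Λ Finset.univ (partialDynamics 𝓛 Λ s r A)
      - partialGenerator 𝓛 Λ s (partialDynamics 𝓛 Λ s r A)‖ ≤ _
    rw [← LinearMap.sub_apply, hsub]
    refine (norm_partialGenerator_apply_le _ _).trans ?_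
    refine (Finset.sum_le_sum fun Z _ => lieb_robinson h s hA Z hr).trans ?_
    have h1 := h.sum_mul_reach_le sᶜ (W := W) (R := R)
      (fun Z hZ => hR Z (Finset.mem_compl.1 hZ)) hr
    refine le_trans (le_of_eq ?_) (mul_le_mul_of_nonneg_left h1 (norm_nonneg A))
    rw [Finset.mul_sum]
    exact Finset.sum_congr rfl fun _ _ => by ring

end LiebRobinson

/-! ### Decay bounds from `F`-functions -/

section FFunction

variable {Γ : Type*} [MetricSpace Γ] {F : ℝ → ℝ}

/-- By the triangle inequality the weights satisfy `e^{-ad(x,z)} e^{-ad(z,y)} ≤ e^{-ad(x,y)}`, so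
any convolution constant of `F` remains admissible. -/
theorem IsFFunction.expWeight (hF : IsFFunction Γ F) {a : ℝ} (ha : 0 ≤ a) :
    IsFFunction Γ (expWeight a F) where
  pos r hr := mul_pos (Real.exp_pos _) (hF.pos r hr)
  antitone r hr r' hr' h :=
    mul_le_mul (Real.exp_le_exp.2 (neg_le_neg (mul_le_mul_of_nonneg_left h ha)))
      (hF.antitone hr hr' h) (hF.pos r' hr').le (Real.exp_pos _).le
  summable x := (hF.summable x).of_nonneg_of_le
    (fun y => (mul_pos (Real.exp_pos _) (hF.pos _ dist_nonneg)).le)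
    (fun y => mul_le_of_le_one_left (hF.pos _ dist_nonneg).le
      (Real.exp_le_one_iff.2 (neg_nonpos.2 (mul_nonneg ha dist_nonneg))))
  bounded := by
    have hle : ∀ x y : Γ, OpenSpin.expWeight a F (dist x y) ≤ F (dist x y) := fun x y =>
      mul_le_of_le_one_left (hF.pos _ dist_nonneg).le
        (Real.exp_le_one_iff.2 (neg_nonpos.2 (mul_nonneg ha dist_nonneg)))
    obtain ⟨b, hb⟩ := hF.bounded
    refine ⟨b, ?_⟩
    rintro _ ⟨x, rfl⟩
    refine le_trans (Summable.tsum_le_tsum (hle x) ?_ (hF.summable x)) (hb ⟨x, rfl⟩)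
    exact (hF.summable x).of_nonneg_of_le
      (fun y => (mul_pos (Real.exp_pos _) (hF.pos _ dist_nonneg)).le) (hle x)
  convolution := by
    obtain ⟨C, hC, h⟩ := hF.convolution
    refine ⟨C, hC, fun x y => ?_⟩
    have hle : ∀ z : Γ, OpenSpin.expWeight a F (dist x z) * OpenSpin.expWeight a F (dist z y)
        ≤ Real.exp (-(a * dist x y)) * (F (dist x z) * F (dist z y)) := by
      intro z
      have h1 : Real.exp (-(a * dist x z)) * Real.exp (-(a * dist z y))
          ≤ Real.exp (-(a * dist x y)) := by
        rw [← Real.exp_add]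
        refine Real.exp_le_exp.2 ?_
        have := mul_le_mul_of_nonneg_left (dist_triangle x z y) ha
        linarith
      calc _ = Real.exp (-(a * dist x z)) * Real.exp (-(a * dist z y))
            * (F (dist x z) * F (dist z y)) := by simp only [OpenSpin.expWeight]; ring
        _ ≤ _ := mul_le_mul_of_nonneg_right h1
          (mul_pos (hF.pos _ dist_nonneg) (hF.pos _ dist_nonneg)).le
    have hs := (h x y).1.mul_left (Real.exp (-(a * dist x y)))
    have hs' := hs.of_nonneg_of_le (fun z => (mul_pos (mul_pos (Real.exp_pos _)
      (hF.pos _ dist_nonneg)) (mul_pos (Real.exp_pos _) (hF.pos _ dist_nonneg))).le) hle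
    refine ⟨hs', (hs'.tsum_le_tsum hle hs).trans ?_⟩
    rw [tsum_mul_left]
    refine (mul_le_mul_of_nonneg_left (h x y).2 (Real.exp_pos _).le).trans_eq ?_
    simp only [OpenSpin.expWeight]; ring

/-- The diagonal term `z = x = y` gives `F 0 ^ 2 ≤ C * F 0`, hence `C ≥ F 0`. -/
theorem IsFFunction.convConst_pos [Nonempty Γ] (hF : IsFFunction Γ F) : 0 < convConst Γ F := by
  refine (hF.pos 0 le_rfl).trans_le (le_csInf hF.convolution fun C hC => ?_)
  have x : Γ := Classical.arbitrary _
  obtain ⟨hs, hle⟩ := hC.2 x x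
  have h1 := hs.le_tsum x fun z _ =>
    (mul_pos (hF.pos _ dist_nonneg) (hF.pos _ dist_nonneg)).le
  have h2 := h1.trans hle
  simp only [dist_self] at h2
  exact le_of_mul_le_mul_right h2 (hF.pos 0 le_rfl)

theorem IsFFunction.sum_conv_le (hF : IsFFunction Γ F) (Λ : Finset Γ) (x y : Γ) :
    ∑ z ∈ Λ, F (dist x z) * F (dist z y) ≤ convConst Γ F * F (dist x y) := by
  have hpos := hF.pos (dist x y) dist_nonneg
  rw [← div_le_iff₀ hpos]
  refine le_csInf hF.convolution fun C hC => ?_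
  rw [div_le_iff₀ hpos]
  exact ((hC.2 x y).1.sum_le_tsum Λ fun z _ =>
    (mul_pos (hF.pos _ dist_nonneg) (hF.pos _ dist_nonneg)).le).trans (hC.2 x y).2

theorem IsFFunction.FFunNorm_nonneg (hF : IsFFunction Γ F) : 0 ≤ FFunNorm Γ F :=
  Real.iSup_nonneg fun _ => tsum_nonneg fun _ => (hF.pos _ dist_nonneg).le

theorem IsFFunction.sum_expWeight_le (hF : IsFFunction Γ F) {a : ℝ} (ha : 0 ≤ a) (r : ℝ)
    (s : Finset Γ) (w : Γ) (hs : ∀ y ∈ s, r ≤ dist y w) :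
    ∑ y ∈ s, OpenSpin.expWeight a F (dist y w) ≤ Real.exp (-(a * r)) * FFunNorm Γ F := by
  calc _ ≤ ∑ y ∈ s, Real.exp (-(a * r)) * F (dist w y) := by
        refine Finset.sum_le_sum fun y hy => ?_
        rw [OpenSpin.expWeight, dist_comm w y]
        exact mul_le_mul_of_nonneg_right (Real.exp_le_exp.2 (neg_le_neg
          (mul_le_mul_of_nonneg_left (hs y hy) ha))) (hF.pos _ dist_nonneg).le
    _ = Real.exp (-(a * r)) * ∑ y ∈ s, F (dist w y) := (Finset.mul_sum _ _ _).symm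
    _ ≤ _ := mul_le_mul_of_nonneg_left (((hF.summable w).sum_le_tsum s
        fun _ _ => (hF.pos _ dist_nonneg).le).trans (le_ciSup hF.bounded w)) (Real.exp_pos _).le

variable [DecidableEq Γ] {S : Γ → Type*} [∀ x, Fintype (S x)] [∀ x, DecidableEq (S x)]
  {𝓛 : Interaction S}

theorem FNorm_nonneg [Nonempty Γ] (hF : IsFFunction Γ F) : 0 ≤ FNorm 𝓛 F := by
  refine Real.sInf_nonneg fun M hM => ?_
  have x : Γ := Classical.arbitrary _
  have h := (tsum_nonneg fun Z => cbNorm_nonneg _).trans (hM x x).2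
  exact nonneg_of_mul_nonneg_left h (hF.pos _ dist_nonneg)

theorem sum_cbNorm_le (hF : IsFFunction Γ F) (h𝓛 : HasFiniteFNorm 𝓛 F) (Λ : Finset Γ) (x y : Γ) :
    ∑ Z : {Z // Z ∈ Λ.powerset}, (if x ∈ Z.1 ∧ y ∈ Z.1 then cbNorm (𝓛.L Z.1) else 0)
      ≤ FNorm 𝓛 F * F (dist x y) := by
  have hpos := hF.pos (dist x y) dist_nonneg
  rw [← div_le_iff₀ hpos]
  refine le_csInf h𝓛 fun M hM => ?_
  rw [div_le_iff₀ hpos]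
  refine le_trans (le_of_eq ?_) (((hM x y).1.sum_le_tsum
    (Λ.powerset.subtype fun Z => x ∈ Z ∧ y ∈ Z) fun Z _ => cbNorm_nonneg _).trans (hM x y).2)
  rw [Finset.sum_coe_sort Λ.powerset
    (fun Z => if x ∈ Z ∧ y ∈ Z then cbNorm (𝓛.L Z) else 0), ← Finset.sum_filter]
  exact (Finset.sum_subtype_eq_sum_filter (s := Λ.powerset) (p := fun Z => x ∈ Z ∧ y ∈ Z)
    (fun Z => cbNorm (𝓛.L Z))).symm

theorem isDecayBound [Nonempty Γ] (hF : IsFFunction Γ F) (h𝓛 : HasFiniteFNorm 𝓛 F)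
    (h𝓛0 : FNorm 𝓛 F ≠ 0) (Λ : Finset Γ) :
    IsDecayBound 𝓛 Λ (fun x y => F (dist x y)) (FNorm 𝓛 F) (convConst Γ F) where
  nonneg _ _ := (hF.pos _ dist_nonneg).le
  pos_M := lt_of_le_of_ne (FNorm_nonneg hF) h𝓛0.symm
  pos_C := hF.convConst_pos
  sum_le := sum_cbNorm_le hF h𝓛 Λ
  conv := hF.sum_conv_le Λ

omit [DecidableEq Γ] in
theorem setDist_le_dist {X Y : Finset Γ} {x y : Γ} (hx : x ∈ X) (hy : y ∈ Y) :
    setDist X Y ≤ dist x y :=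
  ciInf_le (f := fun p : {x // x ∈ X} × {y // y ∈ Y} => dist (p.1 : Γ) (p.2 : Γ))
    (Set.finite_range _).bddBelow (⟨x, hx⟩, ⟨y, hy⟩)

theorem integral_exp_mul_sub_one {v : ℝ} (hv : v ≠ 0) (t : ℝ) :
    ∫ s in (0 : ℝ)..t, (Real.exp (v * s) - 1) = (Real.exp (v * t) - 1) / v - t := by
  rw [intervalIntegral.integral_sub (by apply Continuous.intervalIntegrable; fun_prop)
    (by simp), intervalIntegral.integral_comp_mul_left (fun s => Real.exp s) hv]
  simp
  ring

end FFunction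

/-! ### Decoupled dynamics -/

section Decoupling

variable {Γ : Type*} [DecidableEq Γ] {S : Γ → Type*} [∀ x, Fintype (S x)]
  [∀ x, DecidableEq (S x)] (𝓛 : Interaction S)

/-- The subsets of `Λ` contained in `U` or in `V`. -/
def splitFamily (Λ U V : Finset Γ) : Finset {Z // Z ∈ Λ.powerset} :=
  Finset.univ.filter fun Z => Z.1 ⊆ U ∨ Z.1 ⊆ V

variable [∀ x, Nonempty (S x)]

theorem partialGenerator_mem_left {Λ U V : Finset Γ} {hU : U ⊆ Λ} (hd : Disjoint U V)
    {P : LocalAlg S Λ} (hP : P ∈ supported S hU) :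
    partialGenerator 𝓛 Λ (splitFamily Λ U V) P ∈ supported S hU := by
  rw [partialGenerator, LinearMap.sum_apply]
  refine Submodule.sum_mem _ fun Z hZ => ?_
  rcases (Finset.mem_filter.1 hZ).2 with h | h
  · exact extend_mem_supported 𝓛 _ h hP
  · rw [extend_eq_zero 𝓛 _ (hd.symm.mono_left h) hP]
    exact Submodule.zero_mem _

theorem partialGenerator_mem_right {Λ U V : Finset Γ} {hV : V ⊆ Λ} (hd : Disjoint U V)
    {Q : LocalAlg S Λ} (hQ : Q ∈ supported S hV) :
    partialGenerator 𝓛 Λ (splitFamily Λ U V) Q ∈ supported S hV := by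
  have : splitFamily Λ U V = splitFamily Λ V U := Finset.filter_congr fun _ _ => or_comm
  rw [this]
  exact partialGenerator_mem_left 𝓛 hd.symm hQ

/-- A Lindblad generator is not a derivation in general. Here each term lies on one side, where it
annihilates the other factor and passes through it. -/
theorem partialGenerator_mul {Λ U V : Finset Γ} {hU : U ⊆ Λ} {hV : V ⊆ Λ} (hd : Disjoint U V)
    {P Q : LocalAlg S Λ} (hP : P ∈ supported S hU) (hQ : Q ∈ supported S hV) :
    partialGenerator 𝓛 Λ (splitFamily Λ U V) (P * Q)
      = partialGenerator 𝓛 Λ (splitFamily Λ U V) P * Q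
        + P * partialGenerator 𝓛 Λ (splitFamily Λ U V) Q := by
  simp only [partialGenerator, LinearMap.sum_apply]
  rw [Finset.sum_mul, Finset.mul_sum, ← Finset.sum_add_distrib]
  refine Finset.sum_congr rfl fun Z hZ => ?_
  rcases (Finset.mem_filter.1 hZ).2 with h | h
  · have hZV := hd.mono_left h
    rw [extend_mul_right 𝓛 _ hZV hQ, extend_eq_zero 𝓛 _ hZV hQ, mul_zero, add_zero]
  · have hZU := hd.symm.mono_left h
    rw [extend_mul_left 𝓛 _ hZU hP, extend_eq_zero 𝓛 _ hZU hP, zero_mul, zero_add]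

/-- The decoupled dynamics in a product state factorizes. -/
theorem diagState_partialDynamics_mul {Λ U V : Finset Γ} {hU : U ⊆ Λ} {hV : V ⊆ Λ}
    (hd : Disjoint U V) (σ : Config S Λ) {P Q : LocalAlg S Λ} (hP : P ∈ supported S hU)
    (hQ : Q ∈ supported S hV) {t : ℝ} (ht : 0 ≤ t) :
    diagState σ (partialDynamics 𝓛 Λ (splitFamily Λ U V) t (P * Q))
      = diagState σ (partialDynamics 𝓛 Λ (splitFamily Λ U V) t P)
        * diagState σ (partialDynamics 𝓛 Λ (splitFamily Λ U V) t Q) := by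
  have hM : ∀ x ∈ supported S hU, LinearMap.toContinuousLinearMap
      (partialGenerator 𝓛 Λ (splitFamily Λ U V)) x ∈ supported S hU :=
    fun x hx => partialGenerator_mem_left 𝓛 hd hx
  have hN : ∀ x ∈ supported S hV, LinearMap.toContinuousLinearMap
      (partialGenerator 𝓛 Λ (splitFamily Λ U V)) x ∈ supported S hV :=
    fun x hx => partialGenerator_mem_right 𝓛 hd hx
  rw [partialDynamics, semigroup_mul (isDissipative_partialGenerator 𝓛 Λ _)
    (isClosed_supported hU) (isClosed_supported hV) hM hN
    (fun p hp q hq => partialGenerator_mul 𝓛 hd hp hq) hP hQ ht]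
  exact diagState_mul hd σ (semigroup_mem (isClosed_supported hU) hM hP t)
    (semigroup_mem (isClosed_supported hV) hN hQ t)

end Decoupling

/-! ### Clustering of local dynamical fixed points -/

/-- The triangle inequality behind the clustering estimate. -/
theorem norm_sub_mul_le_of_factorization {pab pa pb wab wa wb sab sa sb : ℂ} {α β g ε₁ ε₂ ε₃ : ℝ}
    (hα : 0 ≤ α) (hs : sab = sa * sb) (h1 : ‖pab - wab‖ ≤ g * (α * β))
    (h2 : ‖pa - wa‖ ≤ g * α) (h3 : ‖pb - wb‖ ≤ g * β) (h4 : ‖wab - sab‖ ≤ ε₁)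
    (h5 : ‖wa - sa‖ ≤ ε₂) (h6 : ‖wb - sb‖ ≤ ε₃) (hpa : ‖pa‖ ≤ α) (hwb : ‖wb‖ ≤ β)
    (hwa : ‖wa‖ ≤ α) (hsb : ‖sb‖ ≤ β) :
    ‖pab - pa * pb‖ ≤ ε₁ + ε₂ * β + α * ε₃ + 3 * α * β * g := by
  -- The letters `p`, `w`, `s` stand for the fixed point, the evolved product state and its
  -- decoupled evolution. Three differences measure convergence and three measure decoupling.
  have e : pab - pa * pb = (pab - wab) + (wab - sab) - (wa - sa) * sb - wa * (wb - sb)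
      - (pa - wa) * wb - pa * (pb - wb) := by rw [hs]; ring
  have m1 : ‖(wa - sa) * sb‖ ≤ ε₂ * β := by
    rw [norm_mul]; exact mul_le_mul h5 hsb (norm_nonneg _) ((norm_nonneg _).trans h5)
  have m2 : ‖wa * (wb - sb)‖ ≤ α * ε₃ := by
    rw [norm_mul]; exact mul_le_mul hwa h6 (norm_nonneg _) hα
  have m3 : ‖(pa - wa) * wb‖ ≤ g * α * β := by
    rw [norm_mul]; exact mul_le_mul h2 hwb (norm_nonneg _) ((norm_nonneg _).trans h2)
  have m4 : ‖pa * (pb - wb)‖ ≤ α * (g * β) := by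
    rw [norm_mul]; exact mul_le_mul hpa h3 (norm_nonneg _) hα
  rw [e]
  refine (norm_sub_le _ _).trans ?_
  have t1 := norm_sub_le ((pab - wab) + (wab - sab) - (wa - sa) * sb - wa * (wb - sb))
    ((pa - wa) * wb)
  have t2 := norm_sub_le ((pab - wab) + (wab - sab) - (wa - sa) * sb) (wa * (wb - sb))
  have t3 := norm_sub_le ((pab - wab) + (wab - sab)) ((wa - sa) * sb)
  have t4 := norm_add_le (pab - wab) (wab - sab)
  linarith

section Clustering

variable {Γ : Type*} [MetricSpace Γ] [DecidableEq Γ] {S : Γ → Type*} [∀ x, Fintype (S x)]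
  [∀ x, DecidableEq (S x)] [∀ x, Nonempty (S x)]

/-- The points of `Λ` at distance less than `r` from `X`. -/
def nbhd (Λ X : Finset Γ) (r : ℝ) : Finset Γ := by
  classical exact Λ.filter fun y => ∃ x ∈ X, dist y x < r

omit [DecidableEq Γ] in
theorem mem_nbhd {Λ X : Finset Γ} {r : ℝ} {y : Γ} :
    y ∈ nbhd Λ X r ↔ y ∈ Λ ∧ ∃ x ∈ X, dist y x < r := by
  simp [nbhd]

omit [DecidableEq Γ] in
theorem disjoint_nbhd (Λ X Y : Finset Γ) :
    Disjoint (nbhd Λ X (setDist X Y / 2)) (nbhd Λ Y (setDist X Y / 2)) := by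
  refine Finset.disjoint_left.2 fun z hz hz' => ?_
  obtain ⟨-, x, hx, hxz⟩ := mem_nbhd.1 hz
  obtain ⟨-, y, hy, hyz⟩ := mem_nbhd.1 hz'
  have h1 := setDist_le_dist hx hy
  have h2 := dist_triangle_left x y z
  linarith

omit [DecidableEq Γ] in
theorem subset_nbhd {Λ X : Finset Γ} (hX : X ⊆ Λ) {r : ℝ} (hr : 0 < r) : X ⊆ nbhd Λ X r :=
  fun x hx => mem_nbhd.2 ⟨hX hx, x, hx, by simpa using hr⟩

/-- The decoupled dynamics approximates the full one on observables supported in `X ∪ Y`. -/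
theorem norm_dynamics_sub_le {F₀ : ℝ → ℝ} (hF₀ : IsFFunction Γ F₀) {a : ℝ} (ha : 0 ≤ a)
    {𝓛 : Interaction S} {Λ : Finset Γ} {M C : ℝ}
    (h : IsDecayBound 𝓛 Λ (fun x y => expWeight a F₀ (dist x y)) M C) (X Y : Finset Γ) (r : ℝ)
    {W : Finset Γ} (hW : W ⊆ Λ) (hWXY : W ⊆ X ∪ Y) {A : LocalAlg S Λ} (hA : A ∈ supported S hW)
    {t : ℝ} (ht : 0 ≤ t) :
    ‖partialDynamics 𝓛 Λ Finset.univ t A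
        - partialDynamics 𝓛 Λ (splitFamily Λ (nbhd Λ X r) (nbhd Λ Y r)) t A‖ ≤
      ‖A‖ * ((Real.exp (M * C * t) - 1) / C *
        (W.card * (Real.exp (-(a * r)) * FFunNorm Γ F₀))) := by
  classical
  -- A discarded `Z` leaves both neighbourhoods, hence has a point far from any prescribed `w`,
  -- whether `w` lies in `X` or in `Y`.
  have hfar : ∀ {V Z : Finset Γ} {w : Γ}, Z ⊆ Λ → ¬ Z ⊆ nbhd Λ V r → w ∈ V →
      ∃ y ∈ Λ.filter (fun y => r ≤ dist y w), y ∈ Z := by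
    intro V Z w hZ hn hw
    obtain ⟨y, hy, hyn⟩ := Finset.not_subset.1 hn
    refine ⟨y, Finset.mem_filter.2 ⟨hZ hy, ?_⟩, hy⟩
    by_contra hlt
    exact hyn (mem_nbhd.2 ⟨hZ hy, w, hw, not_le.1 hlt⟩)
  refine (norm_partialDynamics_sub_le h _ hA (R := fun w => Λ.filter fun y => r ≤ dist y w)
    (fun Z hZ w hw => ?_) ht).trans ?_
  · have hn : ¬ (Z.1 ⊆ nbhd Λ X r ∨ Z.1 ⊆ nbhd Λ Y r) := fun H =>
      hZ (Finset.mem_filter.2 ⟨Finset.mem_univ _, H⟩)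
    have hZΛ := Finset.mem_powerset.1 Z.2
    rcases Finset.mem_union.1 (hWXY hw) with hw | hw
    · exact hfar hZΛ (fun H => hn (Or.inl H)) hw
    · exact hfar hZΛ (fun H => hn (Or.inr H)) hw
  · have hC := h.pos_C
    refine mul_le_mul_of_nonneg_left (mul_le_mul_of_nonneg_left ?_ ?_) (norm_nonneg A)
    · rw [← nsmul_eq_mul]
      exact Finset.sum_le_card_nsmul _ _ _ fun w _ => hF₀.sum_expWeight_le ha r _ w
        fun y hy => (Finset.mem_filter.1 hy).2
    · exact div_nonneg (sub_nonneg.2 (Real.one_le_exp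
        (mul_nonneg (mul_nonneg h.pos_M.le hC.le) ht))) hC.le

/-- Clustering of a local dynamical fixed point, with the error expressed through the growth
factor of the Lieb-Robinson bound. -/
theorem norm_correlation_le {F₀ : ℝ → ℝ} (hF₀ : IsFFunction Γ F₀) {a : ℝ} (ha : 0 ≤ a)
    {𝓛 : Interaction S} {Λ : Finset Γ} {M C : ℝ}
    (h : IsDecayBound 𝓛 Λ (fun x y => expWeight a F₀ (dist x y)) M C)
    {π : LocalAlg S Λ →ₗ[ℂ] ℂ} {g : ℝ → ℝ} (hπ : IsLocalDynamicalFixedPoint 𝓛 Λ π g)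
    {X Y : Finset Γ} (hX : X ⊆ Λ) (hY : Y ⊆ Λ) (hXY : 0 < setDist X Y)
    (A : LocalAlg S X) (B : LocalAlg S Y) {t : ℝ} (ht : 0 ≤ t) :
    ‖π (embed hX A * embed hY B) - π (embed hX A) * π (embed hY B)‖ ≤
      2 * ‖A‖ * ‖B‖ * ((X.card : ℝ) + (Y.card : ℝ)) * FFunNorm Γ F₀
          * ((Real.exp (M * C * t) - 1) / C) * Real.exp (-(a * setDist X Y / 2))
        + 3 * ‖A‖ * ‖B‖ * g t := by
  set d := setDist X Y with hd
  set U := nbhd Λ X (d / 2) with hU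
  set V := nbhd Λ Y (d / 2) with hV
  have hUΛ : U ⊆ Λ := fun y hy => (mem_nbhd.1 hy).1
  have hVΛ : V ⊆ Λ := fun y hy => (mem_nbhd.1 hy).1
  have hXU : X ⊆ U := subset_nbhd hX (half_pos hXY)
  have hYV : Y ⊆ V := subset_nbhd hY (half_pos hXY)
  have hUV : Disjoint U V := disjoint_nbhd Λ X Y
  have hXYΛ : X ∪ Y ⊆ Λ := Finset.union_subset hX hY
  set P := embed hX A with hP
  set Q := embed hY B with hQ
  have hPn : ‖P‖ ≤ ‖A‖ := norm_embed_le hX A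
  have hQn : ‖Q‖ ≤ ‖B‖ := norm_embed_le hY B
  have hPQn : ‖P * Q‖ ≤ ‖A‖ * ‖B‖ :=
    (norm_mul_le _ _).trans (mul_le_mul hPn hQn (norm_nonneg _) (norm_nonneg _))
  have hPX : P ∈ supported S hX := mem_supported.2 ⟨A, rfl⟩
  have hQY : Q ∈ supported S hY := mem_supported.2 ⟨B, rfl⟩
  have hPQ : P * Q ∈ supported S hXYΛ :=
    mul_mem_supported (embed_mem_supported Finset.subset_union_left hX hXYΛ A)
      (embed_mem_supported Finset.subset_union_right hY hXYΛ B)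
  have σ : Config S Λ := Classical.arbitrary _
  set ω := diagState σ with hω
  have hωs : IsState ω := isState_diagState σ
  set T : LocalAlg S Λ →L[ℂ] LocalAlg S Λ := partialDynamics 𝓛 Λ Finset.univ t with hT
  set D : LocalAlg S Λ →L[ℂ] LocalAlg S Λ := partialDynamics 𝓛 Λ (splitFamily Λ U V) t with hD
  have hTdyn : dynamics 𝓛 Λ t = T := rfl
  have hg : 0 ≤ g t := (hπ.range t ht).1
  have hconv : ∀ N : LocalAlg S Λ, ∀ c : ℝ, ‖N‖ ≤ c → ‖π N - ω (T N)‖ ≤ g t * c := by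
    intro N c hN
    have := hπ.convergence ω hωs N t ht
    rw [hπ.invariant t ht N, hTdyn] at this
    exact this.trans (mul_le_mul_of_nonneg_left hN hg)
  have hcontr : ∀ (s : Finset {Z // Z ∈ Λ.powerset}) (N : LocalAlg S Λ),
      ‖ω (partialDynamics 𝓛 Λ s t N)‖ ≤ ‖N‖ := fun s N =>
    (hωs.norm_apply_le _).trans
      (norm_semigroup_le (isDissipative_partialGenerator 𝓛 Λ s) ht N)
  set G := (Real.exp (M * C * t) - 1) / C with hG
  have hG0 : 0 ≤ G := div_nonneg (sub_nonneg.2 (Real.one_le_exp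
    (mul_nonneg (mul_nonneg h.pos_M.le h.pos_C.le) ht))) h.pos_C.le
  set δ := G * (Real.exp (-(a * (d / 2))) * FFunNorm Γ F₀) with hδ
  have hδ0 : 0 ≤ δ := mul_nonneg hG0 (mul_nonneg (Real.exp_pos _).le hF₀.FFunNorm_nonneg)
  have herr : ∀ {W : Finset Γ} (hW : W ⊆ Λ), W ⊆ X ∪ Y → ∀ {N : LocalAlg S Λ},
      N ∈ supported S hW → ∀ c : ℝ, ‖N‖ ≤ c → ‖ω (T N) - ω (D N)‖ ≤ c * (W.card * δ) := by
    intro W hW hWXY N hN c hc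
    rw [← map_sub]
    refine (hωs.norm_apply_le _).trans
      ((norm_dynamics_sub_le hF₀ ha h X Y (d / 2) hW hWXY hN ht).trans ?_)
    refine le_trans (le_of_eq ?_) (mul_le_mul_of_nonneg_right hc
      (mul_nonneg (Nat.cast_nonneg W.card) hδ0))
    rw [hδ, hG]
    ring
  have hcard : ((X ∪ Y).card : ℝ) * δ ≤ ((X.card : ℝ) + Y.card) * δ :=
    mul_le_mul_of_nonneg_right (by exact_mod_cast Finset.card_union_le X Y) hδ0
  have key := norm_sub_mul_le_of_factorization (norm_nonneg A)
    (diagState_partialDynamics_mul 𝓛 hUV σ (embed_mem_supported hXU hX hUΛ A)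
      (embed_mem_supported hYV hY hVΛ B) ht)
    (hconv (P * Q) _ hPQn) (hconv P _ hPn) (hconv Q _ hQn)
    (herr hXYΛ subset_rfl hPQ _ hPQn) (herr hX Finset.subset_union_left hPX _ hPn)
    (herr hY Finset.subset_union_right hQY _ hQn)
    ((hπ.isState.norm_apply_le P).trans hPn) ((hcontr _ Q).trans hQn) ((hcontr _ P).trans hPn)
    ((hcontr _ Q).trans hQn)
  refine key.trans ?_
  -- The factor 2: decoupling `AB` costs `|X ∪ Y| ≤ |X| + |Y|`, and decoupling `A` and `B`
  -- separately costs `|X| + |Y|` again.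
  have h1 := mul_le_mul_of_nonneg_left hcard (mul_nonneg (norm_nonneg A) (norm_nonneg B))
  have h2 : 2 * ‖A‖ * ‖B‖ * ((X.card : ℝ) + (Y.card : ℝ)) * FFunNorm Γ F₀ * G
      * Real.exp (-(a * d / 2)) = 2 * (‖A‖ * ‖B‖ * (((X.card : ℝ) + Y.card) * δ)) := by
    rw [hδ, mul_div_assoc a d 2]
    ring
  rw [h2]
  linarith

end Clustering

end OpenSpin

end

/-! ### The clustering bound in its final form -/

theorem lemma3p5 {Γ : Type*} [MetricSpace Γ] [Countable Γ] [DecidableEq Γ]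
    (S : Γ → Type*) [∀ x, Fintype (S x)] [∀ x, DecidableEq (S x)] [∀ x, Nonempty (S x)]
    (F₀ : ℝ → ℝ) (hF₀ : OpenSpin.IsFFunction Γ F₀)
    (a : ℝ) (ha : 0 < a)
    (Fa : ℝ → ℝ) (hFa : Fa = OpenSpin.expWeight a F₀)
    (𝓛 : OpenSpin.Interaction S)
    (h𝓛 : OpenSpin.HasFiniteFNorm 𝓛 Fa) (h𝓛0 : OpenSpin.FNorm 𝓛 Fa ≠ 0)
    (Λ : Finset Γ) (π : OpenSpin.LocalAlg S Λ →ₗ[ℂ] ℂ) (g : ℝ → ℝ)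
    (hπ : OpenSpin.IsLocalDynamicalFixedPoint 𝓛 Λ π g)
    (X Y : Finset Γ) (hX : X ⊆ Λ) (hY : Y ⊆ Λ) (hXne : X.Nonempty) (hYne : Y.Nonempty)
    (hXY : 2 < OpenSpin.setDist X Y)
    (A : OpenSpin.LocalAlg S X) (B : OpenSpin.LocalAlg S Y)
    (v t : ℝ) (hv : v = OpenSpin.FNorm 𝓛 Fa * OpenSpin.convConst Γ Fa)
    (ht : t = a * OpenSpin.setDist X Y / (4 * v)) :
    ‖π (OpenSpin.embed hX A * OpenSpin.embed hY B)
        - π (OpenSpin.embed hX A) * π (OpenSpin.embed hY B)‖ ≤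
      2 * ‖A‖ * ‖B‖ * ((X.card : ℝ) + (Y.card : ℝ))
          * OpenSpin.FNorm 𝓛 Fa * OpenSpin.FFunNorm Γ F₀
          * (t + (OpenSpin.convConst Γ Fa + OpenSpin.FFunNorm Γ Fa) / OpenSpin.convConst Γ Fa
              * ∫ s in (0 : ℝ)..t, (Real.exp (v * s) - 1))
          * Real.exp (-(a * OpenSpin.setDist X Y / 2))
        + 3 * ‖A‖ * ‖B‖ * g t := by
  obtain ⟨x₀, _⟩ := hXne
  have : Nonempty Γ := ⟨x₀⟩
  have hFFa : OpenSpin.IsFFunction Γ Fa := hFa ▸ hF₀.expWeight ha.le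
  have hbound := OpenSpin.isDecayBound hFFa h𝓛 h𝓛0 Λ
  have hM := hbound.pos_M
  have hC := hbound.pos_C
  have hv0 : 0 < v := hv ▸ mul_pos hM hC
  have hd0 : 0 < OpenSpin.setDist X Y := two_pos.trans hXY
  have ht0 : 0 ≤ t := by rw [ht]; positivity
  set M := OpenSpin.FNorm 𝓛 Fa with hMdef
  set C := OpenSpin.convConst Γ Fa with hCdef
  have key := OpenSpin.norm_correlation_le hF₀ ha.le (hFa ▸ hbound) hπ hX hY hd0 A B ht0
  refine key.trans (add_le_add_left ?_ _)
  rw [OpenSpin.integral_exp_mul_sub_one hv0.ne', ← hv]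
  set I := (Real.exp (v * t) - 1) / v - t with hI
  have hI0 : 0 ≤ I := by
    rw [hI, sub_nonneg, le_div_iff₀ hv0]
    linarith [Real.add_one_le_exp (v * t)]
  -- As `v = MC`, the left side equals `M (t + ∫₀ᵗ (e^{vs} - 1) ds)`; the coefficient `(C + ‖Fa‖)/C
  -- ≥ 1` only enlarges the integral term, which is nonnegative.
  have hgrow : (Real.exp (v * t) - 1) / C ≤
      M * (t + (C + OpenSpin.FFunNorm Γ Fa) / C * I) := by
    have h1 : (Real.exp (v * t) - 1) / C = M * (t + I) := by
      rw [hI, add_sub_cancel, hv]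
      field_simp
    have h2 : 1 ≤ (C + OpenSpin.FFunNorm Γ Fa) / C := by
      rw [le_div_iff₀ hC]
      linarith [hFFa.FFunNorm_nonneg]
    rw [h1]
    exact mul_le_mul_of_nonneg_left (add_le_add_right (le_mul_of_one_le_left hI0 h2) t) hM.le
  have hc : 0 ≤ 2 * ‖A‖ * ‖B‖ * ((X.card : ℝ) + (Y.card : ℝ)) * OpenSpin.FFunNorm Γ F₀ :=
    mul_nonneg (by positivity) hF₀.FFunNorm_nonneg
  refine (mul_le_mul_of_nonneg_right (mul_le_mul_of_nonneg_left hgrow hc)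
    (Real.exp_pos _).le).trans_eq ?_
  ring
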